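/- Consider the ODE $y'''=\frac{(y'')^2}{x}-\frac{y''}{y'}$ over the complex numbers, on the first jet domain $D=\{(x,y,p)\in\mathbb C^3: x\ne0,\ p\ne0\}$, $p=y'$. A \emph{contact symmetry} on an open set $U\subseteq D$ is a holomorphic local diffeomorphism $(x,y,p)\mapsto(\hat x,\hat y,\hat p)$ from $U$ to $D$ that satisfies the contact condition $$\hat y_x+p\hat y_y=(\hat x_x+p\hat x_y)\hat p,\qquad \hat y_p=\hat x_p\,\hat p,$$ and whose prolongation, defined with the total derivative $\mathcal D=\partial_x+y'\partial_y+y''\partial_{y'}+y'''\partial_{y''}+\cdots$ by $\hat y''=\mathcal D\hat p/\mathcal D\hat x$ and $\hat y'''=\mathcal D\hat y''/\mathcal D\hat x$ wherever $\mathcal D\hat x\neq0$, satisfies $\hat y'''=(\hat y'')^2/\hat x-\hat y''/\hat p$ whenever the ODE holds; a \emph{global} contact symmetry is a bijection of $D$ that is a contact symmetry on $D$. The infinitesimal generators of Lie contact symmetries are the vector fields $-Q_p\partial_x+(Q-pQ_p)\partial_y+(Q_x+pQ_y)\partial_p$ whose characteristic function $Q$ is holomorphic on $D$ and satisfies the linearized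 symmetry condition of the ODE. Let $C_{\mathbb C}$ be the group of transformations of $D$ generated by the one-parameter groups $\varepsilon\mapsto\exp(\varepsilon X)$, $\varepsilon\in\mathbb R$, of these generators $X$, and let $C$ (the group of continuous symmetries) be generated by those for which $Q$ is real at real points. Put $$\Gamma_1:(x,y,y')\mapsto(ix,-y,iy'),\qquad \Gamma_2:(x,y,y')\mapsto(y',\,xy'-y,\,x),$$ so that $\Gamma_2$ is the prolonged Legendre transform, and let $H$ be the group generated by $\Gamma_1$ and $\Gamma_2$. Then: (1) The global contact symmetries form a group under composition, and this group contains $C$ and $C_{\mathbb C}$. (2) Every contact symmetry on a non-empty connected open set $U\subseteq D$ is the restriction to $U$ of $h\circ c$ for some $h\in H$ and $c\in C_{\mathbb C}$. (3) The global contact symmetries $\Gamma$ with $\Gamma C\Gamma^{-1}=C$ form a group $G$ that contains $C$ as a normal subgroup and contains $\Gamma_1$ and $\Gamma_2$. The quotient $G/C$, the group of discrete contact symmetries up to equivalence under the continuous symmetries, has eight elements, and there is an isomorphism $G/C\cong\mathbb Z_4\times\mathbb Z_2$ that sends the class of $\Gamma_1$ to $(1,0)$ and the class of $\Gamma_2$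 to $(0,1)$. Moreover $H$ has eight elements, $H\cong\mathbb Z_4\times\mathbb Z_2$, and each element of $G$ is equivalent modulo $C$ to exactly one element of $H$. -/

import Mathlib

/-! Holomorphic contact symmetries of the third order ODE `y''' = y''^2 / x - y'' / y'`.
Jets are written `(x, y, p, q, r, s) = (x, y, y', y'', y''', y'''')`. -/

namespace ContactODE

/-- The space of first jets `(x, y, p)`. -/
abbrev J1 : Type := ℂ × ℂ × ℂ

/-- The space of second jets `(x, y, p, q)`. -/
abbrev J2 : Type := ℂ × ℂ × ℂ × ℂ

/-- The space of third jets `(x, y, p, q, r)`. -/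
abbrev J3 : Type := ℂ × ℂ × ℂ × ℂ × ℂ

/-- The space of fourth jets `(x, y, p, q, r, s)`. -/
abbrev J4 : Type := ℂ × ℂ × ℂ × ℂ × ℂ × ℂ

/-- The total derivative `∂_x + p ∂_y + q ∂_p` on functions of `(x, y, p)`. -/
noncomputable def totalD1 (f : J1 → ℂ) (w : J2) : ℂ :=
  fderiv ℂ f (w.1, w.2.1, w.2.2.1) (1, w.2.2.1, w.2.2.2)

/-- The total derivative `∂_x + p ∂_y + q ∂_p + r ∂_q` on functions of `(x, y, p, q)`. -/
noncomputable def totalD2 (f : J2 → ℂ) (w : J3) : ℂ :=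
  fderiv ℂ f (w.1, w.2.1, w.2.2.1, w.2.2.2.1) (1, w.2.2.1, w.2.2.2.1, w.2.2.2.2)

/-- The total derivative `∂_x + p ∂_y + q ∂_p + r ∂_q + s ∂_r` on functions of
`(x, y, p, q, r)`. -/
noncomputable def totalD3 (f : J3 → ℂ) (w : J4) : ℂ :=
  fderiv ℂ f (w.1, w.2.1, w.2.2.1, w.2.2.2.1, w.2.2.2.2.1)
    (1, w.2.2.1, w.2.2.2.1, w.2.2.2.2.1, w.2.2.2.2.2)

/-- The partial derivatives with respect to `x`, `y`, `p`. -/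
noncomputable def partialX (f : J1 → ℂ) (z : J1) : ℂ := fderiv ℂ f z (1, 0, 0)

noncomputable def partialY (f : J1 → ℂ) (z : J1) : ℂ := fderiv ℂ f z (0, 1, 0)

noncomputable def partialP (f : J1 → ℂ) (z : J1) : ℂ := fderiv ℂ f z (0, 0, 1)

/-- The right-hand side `q ^ 2 / x - q / p` of the ODE. -/
noncomputable def omega (w : J2) : ℂ := w.2.2.2 ^ 2 / w.1 - w.2.2.2 / w.2.2.1

/-- The set of first jets over which the ODE is defined: `x ≠ 0` and `p ≠ 0`. -/
def dom : Set J1 := {z | z.1 ≠ 0 ∧ z.2.2 ≠ 0}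

/-! ### Contact symmetries -/

/-- The three components of a map of the first jet space. -/
def xHat (F : J1 → J1) (z : J1) : ℂ := (F z).1

def yHat (F : J1 → J1) (z : J1) : ℂ := (F z).2.1

def pHat (F : J1 → J1) (z : J1) : ℂ := (F z).2.2

/-- The contact condition at `z = (x, y, p)`:
`ŷ_x + p ŷ_y = (x̂_x + p x̂_y) p̂` and `ŷ_p = x̂_p p̂`. -/
def ContactConditionAt (F : J1 → J1) (z : J1) : Prop :=
  partialX (yHat F) z + z.2.2 * partialY (yHat F) z =
      (partialX (xHat F) z + z.2.2 * partialY (xHat F) z) * pHat F z ∧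
    partialP (yHat F) z = partialP (xHat F) z * pHat F z

/-- The prolongation to second derivatives, `ŷ'' = D p̂ / D x̂`. -/
noncomputable def qHat (F : J1 → J1) (w : J2) : ℂ :=
  totalD1 (pHat F) w / totalD1 (xHat F) w

/-- The prolongation to third derivatives, `ŷ''' = D ŷ'' / D x̂`. -/
noncomputable def rHat (F : J1 → J1) (w : J3) : ℂ :=
  totalD2 (qHat F) w / totalD1 (xHat F) (w.1, w.2.1, w.2.2.1, w.2.2.2.1)

/-- The symmetry condition over `z = (x, y, p)`: for every `q` at which the prolongation is
defined, `ŷ''' = ω(x̂, ŷ, p̂, ŷ'')` when `y''' = ω(x, y, p, q)`. -/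
def SymmetryConditionAt (F : J1 → J1) (z : J1) : Prop :=
  ∀ q : ℂ, totalD1 (xHat F) (z.1, z.2.1, z.2.2, q) ≠ 0 →
    rHat F (z.1, z.2.1, z.2.2, q, omega (z.1, z.2.1, z.2.2, q)) =
      omega (xHat F z, yHat F z, pHat F z, qHat F (z.1, z.2.1, z.2.2, q))

/-- `F` is a (local) contact symmetry of the ODE on the open set `U`: a holomorphic local
diffeomorphism on `U`, with values in the domain of the ODE, that satisfies the contact condition
and the symmetry condition. Its values off `U` are irrelevant. -/
structure IsContactSymmetryOn (U : Set J1) (F : J1 → J1) : Prop where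
  holo : DifferentiableOn ℂ F U
  mapsTo : Set.MapsTo F U dom
  localDiffeo : ∀ z ∈ U, Function.Bijective (fderiv ℂ F z)
  contact : ∀ z ∈ U, ContactConditionAt F z
  symm : ∀ z ∈ U, SymmetryConditionAt F z

/-- A bijection of `dom` is a (global) contact symmetry of the ODE. -/
def IsContactSymmetry (Γ : Equiv.Perm dom) : Prop :=
  ∃ F : J1 → J1, IsContactSymmetryOn dom F ∧ ∀ z : dom, (Γ z : J1) = F z

/-! ### Lie contact symmetries -/

/-- `ξ = -Q_p` for a characteristic function `Q`. -/
noncomputable def xi (Q : J1 → ℂ) (z : J1) : ℂ := -partialP Q z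

/-- `η = Q - p Q_p`. -/
noncomputable def eta (Q : J1 → ℂ) (z : J1) : ℂ := Q z - z.2.2 * partialP Q z

/-- `η⁽¹⁾ = Q_x + p Q_y`. -/
noncomputable def eta1 (Q : J1 → ℂ) (z : J1) : ℂ := partialX Q z + z.2.2 * partialY Q z

/-- `η⁽²⁾ = D² Q - y''' Q_p`. -/
noncomputable def eta2 (Q : J1 → ℂ) (w : J3) : ℂ :=
  totalD2 (totalD1 Q) w - w.2.2.2.2 * partialP Q (w.1, w.2.1, w.2.2.1)

/-- `η⁽³⁾ = D³ Q - y'''' Q_p`. -/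
noncomputable def eta3 (Q : J1 → ℂ) (w : J4) : ℂ :=
  totalD3 (totalD2 (totalD1 Q)) w - w.2.2.2.2.2 * partialP Q (w.1, w.2.1, w.2.2.1)

/-- The vector field `ξ ∂_x + η ∂_y + η⁽¹⁾ ∂_p` with characteristic function `Q`. -/
noncomputable def field (Q : J1 → ℂ) (z : J1) : J1 := (xi Q z, eta Q z, eta1 Q z)

/-- The characteristic functions of the infinitesimal generators of Lie contact symmetries of the
ODE: the holomorphic functions on `dom` that satisfy the linearized symmetry condition
`η⁽³⁾ = ξ ω_x + η ω_y + η⁽¹⁾ ω_p + η⁽²⁾ ω_q` when `y''' = ω`. (The variable `s = y''''` cancels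
in `η⁽³⁾`.) -/
def complexGenerators : Set (J1 → ℂ) :=
  {Q | DifferentiableOn ℂ Q dom ∧ ∀ z ∈ dom, ∀ q s : ℂ,
    eta3 Q (z.1, z.2.1, z.2.2, q, omega (z.1, z.2.1, z.2.2, q), s) =
      fderiv ℂ omega (z.1, z.2.1, z.2.2, q)
        (xi Q z, eta Q z, eta1 Q z,
          eta2 Q (z.1, z.2.1, z.2.2, q, omega (z.1, z.2.1, z.2.2, q)))}

/-- The generators whose characteristic function takes real values at real points: the real Lie
algebra of generators of Lie contact symmetries of the ODE. -/
def realGenerators : Set (J1 → ℂ) :=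
  {Q | Q ∈ complexGenerators ∧
    ∀ x y p : ℝ, ((x : ℂ), (y : ℂ), (p : ℂ)) ∈ dom → (Q ((x : ℂ), (y : ℂ), (p : ℂ))).im = 0}

/-- `φ` is the one-parameter group `ε ↦ exp (ε X)` (`ε` real) of transformations of `dom` whose
infinitesimal generator `X` has characteristic function `Q`. -/
def IsFlow (Q : J1 → ℂ) (φ : ℝ → Equiv.Perm dom) : Prop :=
  φ 0 = 1 ∧ ∀ (z : dom) (ε : ℝ),
    HasDerivAt (fun t : ℝ => (φ t z : J1)) (field Q (φ ε z)) ε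

/-- The group generated by the one-parameter groups whose generators lie in `S`. -/
def flowGroup (S : Set (J1 → ℂ)) : Subgroup (Equiv.Perm dom) :=
  Subgroup.closure {Γ | ∃ Q ∈ S, ∃ φ : ℝ → Equiv.Perm dom, IsFlow Q φ ∧ ∃ ε : ℝ, Γ = φ ε}

/-- The group of (real) continuous contact symmetries. -/
def continuousGroup : Subgroup (Equiv.Perm dom) := flowGroup realGenerators

/-- The group of complex continuous contact symmetries. -/
def complexContinuousGroup : Subgroup (Equiv.Perm dom) := flowGroup complexGenerators

/-! ### The two transformations -/

/-- `(x, y, p) ↦ (i x, -y, i p)`. -/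
noncomputable def gamma1 : Equiv.Perm dom where
  toFun z := ⟨(Complex.I * z.1.1, -z.1.2.1, Complex.I * z.1.2.2),
    mul_ne_zero Complex.I_ne_zero z.2.1, mul_ne_zero Complex.I_ne_zero z.2.2⟩
  invFun z := ⟨(-Complex.I * z.1.1, -z.1.2.1, -Complex.I * z.1.2.2),
    mul_ne_zero (neg_ne_zero.2 Complex.I_ne_zero) z.2.1,
    mul_ne_zero (neg_ne_zero.2 Complex.I_ne_zero) z.2.2⟩
  left_inv z := by
    ext <;> simp [← mul_assoc]
  right_inv z := by
    ext <;> simp [← mul_assoc]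

/-- The prolonged Legendre transform `(x, y, p) ↦ (p, x p - y, x)`. -/
noncomputable def gamma2 : Equiv.Perm dom where
  toFun z := ⟨(z.1.2.2, z.1.1 * z.1.2.2 - z.1.2.1, z.1.1), z.2.2, z.2.1⟩
  invFun z := ⟨(z.1.2.2, z.1.1 * z.1.2.2 - z.1.2.1, z.1.1), z.2.2, z.2.1⟩
  left_inv z := by
    ext <;> simp [mul_comm]
  right_inv z := by
    ext <;> simp [mul_comm]

end ContactODE

/-!
The idea is to determine all contact symmetries explicitly: on a connected open set they are the maps
`(a x, a ^ 2 y + b, a p)` and `(a p, a ^ 2 (x p - y) + b, a x)` with complex `a ≠ 0` and `b`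
(`IsContactSymmetryOn.exists_eqOn`). The group theory then takes place in the group of these maps,
which is generated by the maps `scaling a b` of the first kind and the Legendre transform.

On the contact planes, spanned by `D₁ = ∂_x + p ∂_y` and `D₂ = ∂_p`, a curve with tangent
`D₁ + q D₂` is a solution of the ODE when `q' = q ^ 2 / x - q / p`. Both symmetry conditions are
polynomial equations in `q` of degree three, whose four coefficients are differential equations
between `D₁`, `D₂` and the coordinates. They are studied in an abstract commutative algebra with these
derivations (`ContactFrame`), of which the ring of holomorphic functions on an open set is an instance
(`Hol.frame`); the analysis that this needs is that derivatives of holomorphic functions of several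
variables are holomorphic (`DifferentiableOn.fderiv_apply_const`) and commute.

The linearized condition is overdetermined, and cross-differentiation leaves only the characteristic
functions `c + d (2 y - x p)` (`IsLinearSymmetry.exists_eq`). Their flows are the maps `scaling a b`,
with `a > 0` and `b` real in the case of real generators. For a symmetry `(X, Y, P)` with Jacobian `J`
on the contact planes, the pullbacks of the generators `1` and `2 y - x p` are infinitesimal symmetries
again, with the characteristic functions `1 / J` and `(2 Y - X P) / J`
(`IsSymmetryMap.isLinearSymmetry`). Hence these two functions are known, so that `J` is constant and
`X`, `P` are independent of `y` and homogeneous of degree one in `(x, p)`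
(`IsSymmetryMap.homogeneous`). With this, the symmetry condition itself becomes algebraic and shows
that the Jacobian matrix is constant, and diagonal or antidiagonal with equal entries
(`IsSymmetryMap.exists_eq`).

A scaling normalizes the real continuous symmetries exactly when `a ^ 2` and `b` are real
(`scaling_mem_normalizer_iff`), and the Legendre transform always does. A number with real square is a
positive multiple of a power of `i`, so the quotient consists of the classes of `Γ₁ ^ m Γ₂ ^ k`; they
are pairwise distinct as only the trivial product lies in the continuous group
(`eq_one_of_gammaHom_mem`).
-/

namespace ContactODE

open Set Filter Topology
open scoped ComplexOrder

/-! ### Contact frames and the linearized symmetry condition -/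

/-- A commutative algebra with three derivations that obey the rules of `∂_x + p ∂_y`, `∂_p`, `∂_y`
acting on functions of `(x, y, p)`, in which `x` and `p` have inverses `x'` and `p'`. The algebra of
functions is left abstract, so that the consequences of the symmetry conditions are identities in a
commutative ring. -/
structure ContactFrame (R : Type*) [CommRing R] [Algebra ℂ R] where
  D₁ : Derivation ℂ R R
  D₂ : Derivation ℂ R R
  D₃ : Derivation ℂ R R
  x : R
  y : R
  p : R
  x' : R
  p' : R
  mul_x' : x * x' = 1
  mul_p' : p * p' = 1
  comm₂₁ : ∀ f, D₂ (D₁ f) = D₁ (D₂ f) + D₃ f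
  comm₃₁ : ∀ f, D₃ (D₁ f) = D₁ (D₃ f)
  comm₃₂ : ∀ f, D₃ (D₂ f) = D₂ (D₃ f)
  D₁x : D₁ x = 1
  D₁y : D₁ y = p
  D₁p : D₁ p = 0
  D₂x : D₂ x = 0
  D₂y : D₂ y = 0
  D₂p : D₂ p = 1
  D₃x : D₃ x = 0
  D₃y : D₃ y = 1
  D₃p : D₃ p = 0

namespace ContactFrame

variable {R : Type*} [CommRing R] [Algebra ℂ R] (A : ContactFrame R)

theorem derivation_ofNat (D : Derivation ℂ R R) (n : ℕ) [n.AtLeastTwo] :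
    D (no_index (OfNat.ofNat n : R)) = 0 := by
  rw [← Nat.cast_ofNat (R := R)]
  exact D.map_natCast n

theorem derivation_inv (D : Derivation ℂ R R) {a b : R} (h : a * b = 1) :
    D b = -b ^ 2 * D a := by
  have h1 := congrArg D h
  simp only [Derivation.leibniz, smul_eq_mul, Derivation.map_one_eq_zero] at h1
  linear_combination b * h1 - D b * h

theorem D₁x' : A.D₁ A.x' = -A.x' ^ 2 := by rw [derivation_inv _ A.mul_x', A.D₁x, mul_one]
theorem D₂x' : A.D₂ A.x' = 0 := by rw [derivation_inv _ A.mul_x', A.D₂x, mul_zero]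
theorem D₃x' : A.D₃ A.x' = 0 := by rw [derivation_inv _ A.mul_x', A.D₃x, mul_zero]
theorem D₁p' : A.D₁ A.p' = 0 := by rw [derivation_inv _ A.mul_p', A.D₁p, mul_zero]
theorem D₂p' : A.D₂ A.p' = -A.p' ^ 2 := by rw [derivation_inv _ A.mul_p', A.D₂p, mul_one]
theorem D₃p' : A.D₃ A.p' = 0 := by rw [derivation_inv _ A.mul_p', A.D₃p, mul_zero]

/-- The frame obtained from the Legendre transform `(x, y, p) ↦ (p, x p - y, x)`. It exchanges `D₁`
and `D₂`, so that every identity proved for one holds for the other. -/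
def legendre : ContactFrame R where
  D₁ := A.D₂
  D₂ := A.D₁
  D₃ := -A.D₃
  x := A.p
  y := A.x * A.p - A.y
  p := A.x
  x' := A.p'
  p' := A.x'
  mul_x' := A.mul_p'
  mul_p' := A.mul_x'
  comm₂₁ f := by simp [A.comm₂₁]
  comm₃₁ f := by simp [A.comm₃₂]
  comm₃₂ f := by simp [A.comm₃₁]
  D₁x := A.D₂p
  D₁y := by simp [A.D₂x, A.D₂y, A.D₂p]
  D₁p := A.D₂x
  D₂x := A.D₁p
  D₂y := by simp [A.D₁x, A.D₁y, A.D₁p]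
  D₂p := A.D₁x
  D₃x := by simp [A.D₃p]
  D₃y := by simp [A.D₃x, A.D₃y, A.D₃p]
  D₃p := by simp [A.D₃x]

/-- The linearized symmetry condition for a characteristic function `Q`, split into the
coefficients of the powers of `y''`. -/
structure IsLinearSymmetry (Q : R) : Prop where
  eq₀ : A.D₁ (A.D₁ (A.D₁ Q)) = -A.p' * A.D₁ (A.D₁ Q)
  eq₁ : A.D₁ (A.D₁ (A.D₂ Q)) + A.D₁ (A.D₂ (A.D₁ Q)) + A.D₂ (A.D₁ (A.D₁ Q)) =
    A.p' * A.D₁ (A.D₂ Q) + A.p' ^ 2 * A.D₁ Q + 2 * A.x' * A.D₁ (A.D₁ Q)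
  eq₂ : A.D₂ (A.D₂ (A.D₁ Q)) + A.D₂ (A.D₁ (A.D₂ Q)) + A.D₁ (A.D₂ (A.D₂ Q)) =
    A.x' * A.D₂ (A.D₁ Q) + A.x' ^ 2 * A.D₂ Q + 2 * A.p' * A.D₂ (A.D₂ Q)
  eq₃ : A.D₂ (A.D₂ (A.D₂ Q)) = -A.x' * A.D₂ (A.D₂ Q)

variable {A} {Q : R}

theorem IsLinearSymmetry.legendre (h : A.IsLinearSymmetry Q) :
    A.legendre.IsLinearSymmetry Q :=
  ⟨h.eq₃, h.eq₂, h.eq₁, h.eq₀⟩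

theorem eq_zero_of_ofNat_mul_eq_zero (n : ℕ) [n.AtLeastTwo] {a : R}
    (h : (OfNat.ofNat n : R) * a = 0) : a = 0 := by
  have hn : algebraMap ℂ R (OfNat.ofNat n)⁻¹ * (OfNat.ofNat n : R) = 1 := by
    rw [← map_ofNat (algebraMap ℂ R) n, ← map_mul, inv_mul_cancel₀ (OfNat.ofNat_ne_zero n), map_one]
  linear_combination algebraMap ℂ R (OfNat.ofNat n)⁻¹ * h - a * hn

/-- The function `K = D₂ D₂ Q` obeys `D₂ K = -x' K` by the last equation. Repeated derivatives of
the third equation along `D₂` therefore contain only `K`, `D₁ K` and `D₂ D₂ D₃ Q`, and eliminating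
the last two leaves `(12 x ^ 2 + 6 x p + p ^ 2) K = 0`. -/
theorem IsLinearSymmetry.D₂D₂_eq_zero [IsReduced R] (h : A.IsLinearSymmetry Q) :
    A.D₂ (A.D₂ Q) = 0 := by
  obtain ⟨-, -, h2, h3⟩ := h
  have hx := A.mul_x'
  have hp := A.mul_p'
  have h31 := congrArg A.D₁ h3
  have h33 := congrArg A.D₃ h3
  have h22 := congrArg A.D₂ h2
  simp only [map_add, map_neg, Derivation.leibniz, Derivation.leibniz_pow, smul_eq_mul,
    nsmul_eq_mul, derivation_ofNat, A.comm₂₁, A.comm₃₂, A.D₁x', A.D₂x', A.D₃x', A.D₂p']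
    at h2 h3 h31 h33 h22
  norm_num at h2 h3 h31 h33 h22
  have a : 6 * A.D₂ (A.D₂ (A.D₃ Q)) - 4 * A.x' * A.D₁ (A.D₂ (A.D₂ Q))
      + (2 * A.x' ^ 2 + 2 * A.p' ^ 2 + 2 * A.x' * A.p') * A.D₂ (A.D₂ Q)
      = 2 * A.x' * A.D₂ (A.D₃ Q) := by
    linear_combination h22 - 3 * h31 + 2 * A.p' * h3
  have b := congrArg A.D₂ a
  simp only [map_add, map_sub, Derivation.leibniz, Derivation.leibniz_pow, smul_eq_mul,
    nsmul_eq_mul, derivation_ofNat, A.comm₂₁, A.comm₃₂, A.D₂x', A.D₂p'] at b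
  norm_num at b
  have c : 12 * A.D₂ (A.D₂ (A.D₃ Q)) = 4 * A.x' * A.D₁ (A.D₂ (A.D₂ Q))
      - (6 * A.x' ^ 2 + 4 * A.p' ^ 2 + 2 * A.x' * A.p' + 4 * A.x * A.p' ^ 3)
        * A.D₂ (A.D₂ Q) := by
    linear_combination -A.x * (b - 6 * h33 + 4 * A.x' * h31
      - (2 * A.x' ^ 2 + 2 * A.p' ^ 2 + 2 * A.x' * A.p') * h3)
      - (12 * A.D₂ (A.D₂ (A.D₃ Q)) - 4 * A.x' * A.D₁ (A.D₂ (A.D₂ Q))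
        + (6 * A.x' ^ 2 + 4 * A.p' ^ 2 + 2 * A.x' * A.p') * A.D₂ (A.D₂ Q)) * hx
  have d := congrArg A.D₂ c
  simp only [map_add, map_sub, Derivation.leibniz, Derivation.leibniz_pow, smul_eq_mul,
    nsmul_eq_mul, derivation_ofNat, A.comm₂₁, A.comm₃₂, A.D₂x', A.D₂p', A.D₂x] at d
  norm_num at d
  have e : 4 * A.D₂ (A.D₂ (A.D₃ Q)) =
      -(4 * A.x' ^ 2 + 8 * A.x * A.p' ^ 3 + 2 * A.p' ^ 2 + 12 * A.x ^ 2 * A.p' ^ 4)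
        * A.D₂ (A.D₂ Q) := by
    linear_combination -A.x * (d + A.x' * c - 12 * h33 + 4 * A.x' * h31
      - (6 * A.x' ^ 2 + 4 * A.p' ^ 2 + 2 * A.x' * A.p' + 4 * A.x * A.p' ^ 3) * h3)
      - (4 * A.D₂ (A.D₂ (A.D₃ Q)) + (4 * A.x' ^ 2 + 2 * A.p' ^ 2) * A.D₂ (A.D₂ Q)) * hx
  have f := congrArg A.D₂ e
  simp only [map_add, map_neg, Derivation.leibniz, Derivation.leibniz_pow, smul_eq_mul,
    nsmul_eq_mul, derivation_ofNat, A.D₂x', A.D₂p', A.D₂x] at f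
  norm_num at f
  have g0 : A.p' ^ 5 *
      (4 * ((12 * A.x ^ 2 + 6 * A.x * A.p + A.p ^ 2) * A.D₂ (A.D₂ Q))) = 0 := by
    linear_combination -f - A.x' * e + 4 * h33
      + (4 * A.x' ^ 2 + 8 * A.x * A.p' ^ 3 + 2 * A.p' ^ 2 + 12 * A.x ^ 2 * A.p' ^ 4) * h3
      + (24 * A.x * A.p' ^ 4 + 4 * A.p' ^ 3 * (A.p * A.p' + 1)) * A.D₂ (A.D₂ Q) * hp
  have g : (12 * A.x ^ 2 + 6 * A.x * A.p + A.p ^ 2) * A.D₂ (A.D₂ Q) = 0 := by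
    refine eq_zero_of_ofNat_mul_eq_zero 4 ?_
    exact (((IsUnit.of_mul_eq_one_right _ hp).pow 5).mul_right_eq_zero).1 g0
  -- the quadratic form `12 x ^ 2 + 6 x p + p ^ 2` and its partial derivatives have no common zero
  have g1 := congrArg A.D₁ g
  have g2 := congrArg A.D₂ g
  simp only [map_add, map_zero, Derivation.leibniz, Derivation.leibniz_pow, smul_eq_mul,
    nsmul_eq_mul, derivation_ofNat, A.D₁x, A.D₂x, A.D₁p, A.D₂p] at g1 g2
  norm_num at g1 g2
  have k : A.x * (6 * A.D₂ (A.D₂ Q) ^ 2) = 0 := by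
    linear_combination A.D₂ (A.D₂ Q) * (g1 - 3 * g2)
      - (A.D₁ (A.D₂ (A.D₂ Q)) - 3 * A.D₂ (A.D₂ (A.D₂ Q))) * g
  exact eq_zero_of_pow_eq_zero (eq_zero_of_ofNat_mul_eq_zero 6
    ((IsUnit.of_mul_eq_one _ hx).mul_right_eq_zero.1 k))

/-- As `D₂ D₂ Q` vanishes, the third equation contains only `D₂ Q`, `D₃ Q`, `D₁ D₂ Q` and `D₂ D₃ Q`,
and its derivative along `D₂` isolates the last. -/
theorem IsLinearSymmetry.D₂D₃_eq_zero [IsReduced R] (h : A.IsLinearSymmetry Q) :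
    A.D₂ (A.D₃ Q) = 0 ∧ A.D₂ (A.D₁ Q) = -A.x' * A.D₂ Q := by
  have hK := h.D₂D₂_eq_zero
  have h2 := h.eq₂
  have hx := A.mul_x'
  have hK1 := congrArg A.D₁ hK
  have hK3 := congrArg A.D₃ hK
  simp only [A.comm₂₁, A.comm₃₂, map_zero, map_add] at h2 hK1 hK3
  have h22 := congrArg A.D₂ h2
  simp only [map_add, Derivation.leibniz, Derivation.leibniz_pow, smul_eq_mul, nsmul_eq_mul,
    derivation_ofNat, A.comm₂₁, A.comm₃₂, A.D₂x', A.D₂p'] at h22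
  have hT : A.D₂ (A.D₃ Q) = 0 := by
    refine eq_zero_of_ofNat_mul_eq_zero 2 ?_
    norm_num [hK1, hK3, hK] at h22
    linear_combination -A.x * h22 - 2 * A.D₂ (A.D₃ Q) * hx
  refine ⟨hT, ?_⟩
  rw [A.comm₂₁]
  linear_combination -A.x * h2 + 3 * A.x * hK1 + 3 * A.x * hT - 2 * A.x * A.p' * hK
    - (A.D₁ (A.D₂ Q) + A.D₃ Q + A.x' * A.D₂ Q) * hx

/-- The first derivatives of a solution of the linearized symmetry condition are those of
`D₃ Q / 2` times `2 y - x p`, and `D₃ Q` is constant. -/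
theorem IsLinearSymmetry.derivatives [IsReduced R] (h : A.IsLinearSymmetry Q) :
    2 * A.D₁ Q = A.p * A.D₃ Q ∧ 2 * A.D₂ Q = -A.x * A.D₃ Q ∧
      A.D₁ (A.D₃ Q) = 0 ∧ A.D₂ (A.D₃ Q) = 0 := by
  have hK := h.D₂D₂_eq_zero
  obtain ⟨h23, h21⟩ := h.D₂D₃_eq_zero
  obtain ⟨h13, h12⟩ := h.legendre.D₂D₃_eq_zero
  have hx := A.mul_x'
  have hp := A.mul_p'
  have h13 : A.D₁ (A.D₃ Q) = 0 := by
    rw [← neg_eq_zero, ← map_neg]; exact h13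
  have h12 : A.D₁ (A.D₂ Q) = -A.p' * A.D₁ Q := h12
  have h3 : A.D₃ Q = A.p' * A.D₁ Q - A.x' * A.D₂ Q := by
    linear_combination h21 - h12 - A.comm₂₁ Q
  have h32 := congrArg A.D₂ h3
  simp only [map_sub, Derivation.leibniz, smul_eq_mul, A.D₂x', A.D₂p', hK, h23, h21] at h32
  have k : A.x' * A.D₂ Q + A.p' * A.D₁ Q = 0 := by
    linear_combination A.p * h32 - (A.x' * A.D₂ Q + A.p' * A.D₁ Q) * hp
  refine ⟨?_, ?_, h13, h23⟩
  · linear_combination -A.p * h3 + A.p * k - 2 * A.D₁ Q * hp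
  · linear_combination A.x * h3 + A.x * k - 2 * A.D₂ Q * hx

/-- Every solution of the linearized symmetry condition is a combination of `1` and `2 y - x p`,
provided that the constants of the frame are the complex numbers. -/
theorem IsLinearSymmetry.exists_eq [IsReduced R]
    (hA : ∀ f, A.D₁ f = 0 → A.D₂ f = 0 → ∃ c : ℂ, f = algebraMap ℂ R c)
    (h : A.IsLinearSymmetry Q) :
    ∃ c d : ℂ, Q = algebraMap ℂ R c + algebraMap ℂ R d * (2 * A.y - A.x * A.p) := by
  obtain ⟨h1, h2, h13, h23⟩ := h.derivatives
  obtain ⟨d, hd⟩ := hA _ h13 h23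
  obtain ⟨c, hc⟩ := hA (2 * Q - A.D₃ Q * (2 * A.y - A.x * A.p))
    (by simp only [map_sub, Derivation.leibniz, smul_eq_mul, derivation_ofNat, h13, A.D₁x, A.D₁y,
          A.D₁p]
        linear_combination h1)
    (by simp only [map_sub, Derivation.leibniz, smul_eq_mul, derivation_ofNat, h23, A.D₂x, A.D₂y,
          A.D₂p]
        linear_combination h2)
  -- the ring is a `ℂ`-algebra, so that `2` is invertible
  have half : algebraMap ℂ R 2⁻¹ * 2 = 1 := by
    rw [← map_ofNat (algebraMap ℂ R) 2, ← map_mul, inv_mul_cancel₀ two_ne_zero, map_one]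
  refine ⟨2⁻¹ * c, 2⁻¹ * d, ?_⟩
  rw [map_mul, map_mul, ← hc, ← hd]
  linear_combination -Q * half

end ContactFrame

/-! ### The symmetry condition for contact transformations -/

namespace ContactFrame

variable {R : Type*} [CommRing R] [Algebra ℂ R] {A : ContactFrame R}

variable (A) in
/-- The contact vector field with characteristic function `Q`, applied to `f`. -/
def field (Q f : R) : R := Q * A.D₃ f - A.D₂ Q * A.D₁ f + A.D₁ Q * A.D₂ f

/-- Suppose that the contact vector field with characteristic function `Q` maps to `k` times a
vector field with the components `X`, `P`. Applying it to the equation for `D₁ D₁ X`, and comparing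
with the second derivative of `V X = k X`, leaves an expression that is linear in `D₁ X` and `D₂ X`,
with coefficients that do not depend on `X`. The same holds with `X` and `P` interchanged. -/
theorem transport_D₁D₁ {Q k X P P' f g : R} (hP : P * P' = 1) (hk : A.D₁ k = 0)
    (hX : A.field Q X = k * X) (hVP : A.field Q P = k * P)
    (h₁₁ : A.D₁ (A.D₁ X) = A.D₁ X ^ 2 * P' - A.D₁ X * A.p' + f * A.D₁ X)
    (h₁₂ : A.D₁ (A.D₂ X) + A.D₂ (A.D₁ X) = 2 * A.D₁ X * A.D₂ X * P' + f * A.D₂ X + g * A.D₁ X) :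
    A.D₁ X * (A.D₁ (A.D₁ (A.D₂ Q)) + A.D₁ (A.D₂ Q) * (f - A.p') - g * A.D₁ (A.D₁ Q)
        - A.p' ^ 2 * A.D₁ Q - A.field Q f)
      - A.D₂ X * (A.D₁ (A.D₁ (A.D₁ Q)) + A.p' * A.D₁ (A.D₁ Q)) = 0 := by
  unfold field at *
  have hX1 := congrArg A.D₁ hX
  have hX11 := congrArg A.D₁ hX1
  have h1 := congrArg A.D₁ h₁₁
  have h2 := congrArg A.D₂ h₁₁
  have h3 := congrArg A.D₃ h₁₁
  simp only [map_add, map_sub, Derivation.leibniz, Derivation.leibniz_pow, smul_eq_mul,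
    nsmul_eq_mul, derivation_inv _ hP, A.comm₂₁, A.comm₃₁, A.D₁p', A.D₂p', A.D₃p', hk,
    map_zero] at hX1 hX11 h1 h2 h3 h₁₂
  push_cast at hX1 hX11 h1 h2 h3 h₁₂
  linear_combination Q * h3 - A.D₂ Q * h1 + A.D₁ Q * h2 - hX11
    + (2 * A.D₁ X * P' - A.p' + f) * hX1 - A.D₁ X ^ 2 * P' ^ 2 * hVP
    - A.D₁ X ^ 2 * P' * k * hP - (k + 2 * A.D₁ (A.D₂ Q)) * h₁₁ + A.D₁ (A.D₁ Q) * h₁₂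

/-- The counterpart of `transport_D₁D₁` for the mixed second derivatives. -/
theorem transport_D₁D₂ {Q k X P P' f g : R} (hP : P * P' = 1) (hk : A.D₁ k = 0) (hk₂ : A.D₂ k = 0)
    (hX : A.field Q X = k * X) (hVP : A.field Q P = k * P)
    (h₁₁ : A.D₁ (A.D₁ X) = A.D₁ X ^ 2 * P' - A.D₁ X * A.p' + f * A.D₁ X)
    (h₁₂ : A.D₁ (A.D₂ X) + A.D₂ (A.D₁ X) = 2 * A.D₁ X * A.D₂ X * P' + f * A.D₂ X + g * A.D₁ X)
    (h₂₂ : A.D₂ (A.D₂ X) = A.D₂ X ^ 2 * P' - A.D₂ X * A.x' + g * A.D₂ X) :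
    A.D₁ X * (A.D₁ (A.D₂ (A.D₂ Q)) + A.D₂ (A.D₁ (A.D₂ Q)) + A.D₂ (A.D₂ Q) * (f - 2 * A.p')
        - A.D₂ (A.D₁ Q) * g - A.field Q g)
      - A.D₂ X * (A.D₁ (A.D₂ (A.D₁ Q)) + A.D₂ (A.D₁ (A.D₁ Q)) + A.D₁ (A.D₁ Q) * (g - 2 * A.x')
        - A.D₁ (A.D₂ Q) * f + A.field Q f) = 0 := by
  unfold field at *
  have hX1 := congrArg A.D₁ hX
  have hX2 := congrArg A.D₂ hX
  have hX12 := congrArg A.D₁ hX2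
  have hX21 := congrArg A.D₂ hX1
  have h1 := congrArg A.D₁ h₁₂
  have h2 := congrArg A.D₂ h₁₂
  have h3 := congrArg A.D₃ h₁₂
  simp only [map_add, map_sub, Derivation.leibniz, smul_eq_mul,
    derivation_ofNat, derivation_inv _ hP, A.comm₂₁, A.comm₃₁, A.comm₃₂,
    hk, hk₂, map_zero] at hX1 hX2 hX12 hX21 h1 h2 h3 h₁₂ ⊢
  linear_combination Q * h3 - A.D₂ Q * h1 + A.D₁ Q * h2 - hX12 - hX21
    + (2 * A.D₂ X * P' + g) * hX1 + (2 * A.D₁ X * P' + f) * hX2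
    - 2 * A.D₁ X * A.D₂ X * P' ^ 2 * hVP
    - 2 * A.D₁ X * A.D₂ X * P' * k * hP - (k - A.D₃ Q) * h₁₂
    - 2 * A.D₂ (A.D₂ Q) * h₁₁ + 2 * A.D₁ (A.D₁ Q) * h₂₂

variable (A) in
/-- `(X, Y, P)` are the components of a contact transformation that satisfies the symmetry condition
of the ODE, split into the coefficients of the powers of `y''`. The inverses of `X`, `P` and of
the Jacobian on the contact planes are part of the data. -/
structure IsSymmetryMap (X Y P X' P' J' : R) : Prop where
  mul_X' : X * X' = 1
  mul_P' : P * P' = 1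
  mul_J' : (A.D₁ X * A.D₂ P - A.D₂ X * A.D₁ P) * J' = 1
  contact₁ : A.D₁ Y = P * A.D₁ X
  contact₂ : A.D₂ Y = P * A.D₂ X
  eq₀ : A.D₁ (A.D₁ P) * A.D₁ X - A.D₁ P * A.D₁ (A.D₁ X) =
    A.D₁ X * A.D₁ P * (A.D₁ P * X' - A.D₁ X * P')
  eq₁ : A.D₁ (A.D₁ P) * A.D₂ X + (A.D₁ (A.D₂ P) + A.D₂ (A.D₁ P)) * A.D₁ X
      - A.D₁ P * (A.D₁ (A.D₂ X) + A.D₂ (A.D₁ X)) - A.D₂ P * A.D₁ (A.D₁ X)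
      - A.p' * (A.D₁ X * A.D₂ P - A.D₂ X * A.D₁ P) =
    (A.D₂ X * A.D₁ P ^ 2 + 2 * A.D₁ X * A.D₁ P * A.D₂ P) * X'
      - (A.D₂ P * A.D₁ X ^ 2 + 2 * A.D₁ P * A.D₁ X * A.D₂ X) * P'
  eq₂ : A.D₂ (A.D₂ P) * A.D₁ X + (A.D₁ (A.D₂ P) + A.D₂ (A.D₁ P)) * A.D₂ X
      - A.D₂ P * (A.D₁ (A.D₂ X) + A.D₂ (A.D₁ X)) - A.D₁ P * A.D₂ (A.D₂ X)
      + A.x' * (A.D₁ X * A.D₂ P - A.D₂ X * A.D₁ P) =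
    (A.D₁ X * A.D₂ P ^ 2 + 2 * A.D₂ X * A.D₁ P * A.D₂ P) * X'
      - (A.D₁ P * A.D₂ X ^ 2 + 2 * A.D₂ P * A.D₁ X * A.D₂ X) * P'
  eq₃ : A.D₂ (A.D₂ P) * A.D₂ X - A.D₂ P * A.D₂ (A.D₂ X) =
    A.D₂ X * A.D₂ P * (A.D₂ P * X' - A.D₂ X * P')

/-- If `det (u, w)` is invertible and `a, s, b` are plane vectors for which the cubic
`det (u + q w, a + q s + q ^ 2 b)` vanishes, then `a + q s + q ^ 2 b` is a multiple of `u + q w`. -/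
theorem exists_factor_of_det_eq_zero {S : Type*} [CommRing S]
    {u₁ u₂ w₁ w₂ a₁ a₂ s₁ s₂ b₁ b₂ J' : S}
    (hJ : (u₁ * w₂ - w₁ * u₂) * J' = 1) (h₀ : u₁ * a₂ - u₂ * a₁ = 0)
    (h₁ : u₁ * s₂ - u₂ * s₁ + (w₁ * a₂ - w₂ * a₁) = 0)
    (h₂ : u₁ * b₂ - u₂ * b₁ + (w₁ * s₂ - w₂ * s₁) = 0) (h₃ : w₁ * b₂ - w₂ * b₁ = 0) :
    ∃ f g : S, a₁ = f * u₁ ∧ a₂ = f * u₂ ∧ b₁ = g * w₁ ∧ b₂ = g * w₂ ∧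
      s₁ = f * w₁ + g * u₁ ∧ s₂ = f * w₂ + g * u₂ := by
  refine ⟨(a₁ * w₂ - a₂ * w₁) * J', (u₁ * b₂ - u₂ * b₁) * J', ?_, ?_, ?_, ?_, ?_, ?_⟩
  · linear_combination -a₁ * hJ + w₁ * J' * h₀
  · linear_combination -a₂ * hJ + w₂ * J' * h₀
  · linear_combination -b₁ * hJ - u₁ * J' * h₃
  · linear_combination -b₂ * hJ - u₂ * J' * h₃
  · linear_combination -s₁ * hJ + w₁ * J' * h₁ - u₁ * J' * h₂
  · linear_combination -s₂ * hJ + w₂ * J' * h₁ - u₂ * J' * h₂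

variable {X Y P X' P' J' : R}

/-- A symmetry preserves the second order system `x'' = x' ^ 2 / p`, `p'' = p' ^ 2 / x` up to
reparametrization; the functions `f`, `g` are the coefficients of the change of parameter. -/
theorem IsSymmetryMap.exists_second_derivatives (h : A.IsSymmetryMap X Y P X' P' J') :
    ∃ f g : R,
      A.D₁ (A.D₁ X) = A.D₁ X ^ 2 * P' - A.D₁ X * A.p' + f * A.D₁ X ∧
      A.D₁ (A.D₁ P) = A.D₁ P ^ 2 * X' - A.D₁ P * A.p' + f * A.D₁ P ∧
      A.D₂ (A.D₂ X) = A.D₂ X ^ 2 * P' - A.D₂ X * A.x' + g * A.D₂ X ∧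
      A.D₂ (A.D₂ P) = A.D₂ P ^ 2 * X' - A.D₂ P * A.x' + g * A.D₂ P ∧
      A.D₁ (A.D₂ X) + A.D₂ (A.D₁ X) = 2 * A.D₁ X * A.D₂ X * P' + f * A.D₂ X + g * A.D₁ X ∧
      A.D₁ (A.D₂ P) + A.D₂ (A.D₁ P) = 2 * A.D₁ P * A.D₂ P * X' + f * A.D₂ P + g * A.D₁ P := by
  obtain ⟨f, g, h1, h2, h3, h4, h5, h6⟩ := exists_factor_of_det_eq_zero
    (a₁ := A.D₁ (A.D₁ X) - A.D₁ X ^ 2 * P' + A.D₁ X * A.p')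
    (a₂ := A.D₁ (A.D₁ P) - A.D₁ P ^ 2 * X' + A.D₁ P * A.p')
    (b₁ := A.D₂ (A.D₂ X) - A.D₂ X ^ 2 * P' + A.D₂ X * A.x')
    (b₂ := A.D₂ (A.D₂ P) - A.D₂ P ^ 2 * X' + A.D₂ P * A.x')
    (s₁ := A.D₁ (A.D₂ X) + A.D₂ (A.D₁ X) - 2 * A.D₁ X * A.D₂ X * P')
    (s₂ := A.D₁ (A.D₂ P) + A.D₂ (A.D₁ P) - 2 * A.D₁ P * A.D₂ P * X')
    h.mul_J' (by linear_combination h.eq₀) (by linear_combination h.eq₁)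
    (by linear_combination h.eq₂) (by linear_combination h.eq₃)
  exact ⟨f, g, by linear_combination h1, by linear_combination h2, by linear_combination h3,
    by linear_combination h4, by linear_combination h5, by linear_combination h6⟩

/-- A contact vector field that `(X, Y, P)` maps to `k` times a vector field with the components
`X`, `P` along `∂_x`, `∂_p` is an infinitesimal symmetry. -/
theorem IsSymmetryMap.isLinearSymmetry (h : A.IsSymmetryMap X Y P X' P' J') {Q k : R}
    (hk₁ : A.D₁ k = 0) (hk₂ : A.D₂ k = 0)
    (hX : A.field Q X = k * X) (hP : A.field Q P = k * P) : A.IsLinearSymmetry Q := by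
  obtain ⟨f, g, hX11, hP11, hX22, hP22, hX12, hP12⟩ := h.exists_second_derivatives
  have hJ := h.mul_J'
  -- a combination of the two columns of the invertible Jacobian matrix vanishes only trivially
  have key : ∀ a b : R, A.D₁ X * a - A.D₂ X * b = 0 → A.D₁ P * a - A.D₂ P * b = 0 →
      a = 0 ∧ b = 0 := fun a b h1 h2 => by
    constructor
    · linear_combination -a * hJ + J' * A.D₂ P * h1 - J' * A.D₂ X * h2
    · linear_combination -b * hJ + J' * A.D₁ P * h1 - J' * A.D₁ X * h2
  obtain ⟨e1, e2⟩ := key _ _ (transport_D₁D₁ h.mul_P' hk₁ hX hP hX11 hX12)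
    (transport_D₁D₁ h.mul_X' hk₁ hP hX hP11 hP12)
  obtain ⟨e3, e4⟩ := key _ _ (transport_D₁D₂ h.mul_P' hk₁ hk₂ hX hP hX11 hX12 hX22)
    (transport_D₁D₂ h.mul_X' hk₁ hk₂ hP hX hP11 hP12 hP22)
  -- the equations for `D₂ D₂` are those for `D₁ D₁` after a Legendre transform of the frame
  have lX : A.legendre.field Q X = -k * X := by
    rw [neg_mul, ← hX]; simp only [field, legendre, Derivation.neg_apply]; ring
  have lP : A.legendre.field Q P = -k * P := by
    rw [neg_mul, ← hP]; simp only [field, legendre, Derivation.neg_apply]; ring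
  have lk : A.legendre.D₁ (-k) = 0 := by
    rw [map_neg, neg_eq_zero]; exact hk₂
  have m1 := transport_D₁D₁ (A := A.legendre) (f := g) (g := f) h.mul_P' lk lX lP hX22
    (by simp only [legendre]; linear_combination hX12)
  have m2 := transport_D₁D₁ (A := A.legendre) (f := g) (g := f) h.mul_X' lk lP lX hP22
    (by simp only [legendre]; linear_combination hP12)
  simp only [field, legendre, Derivation.neg_apply] at m1 m2
  obtain ⟨e6, e5⟩ := key (A.D₂ (A.D₂ (A.D₂ Q)) + A.x' * A.D₂ (A.D₂ Q))
    (A.D₂ (A.D₂ (A.D₁ Q)) + A.D₂ (A.D₁ Q) * (g - A.x') - f * A.D₂ (A.D₂ Q) - A.x' ^ 2 * A.D₂ Q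
      + A.field Q g)
    (by unfold field; linear_combination -m1) (by unfold field; linear_combination -m2)
  exact ⟨by linear_combination e2, by linear_combination e1 + e4,
    by linear_combination e3 + e5, by linear_combination e6⟩

/-- The contact condition along `∂_y`, the commutator of `D₂` and `D₁`: the form `dŷ - p̂ dx̂` takes
there the value of the Jacobian determinant of the contact planes. -/
theorem D₃_eq_of_contact (h₁ : A.D₁ Y = P * A.D₁ X) (h₂ : A.D₂ Y = P * A.D₂ X) :
    A.D₃ Y = P * A.D₃ X + (A.D₁ X * A.D₂ P - A.D₂ X * A.D₁ P) := by
  have h21 := A.comm₂₁ Y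
  rw [h₁, h₂] at h21
  simp only [Derivation.leibniz, smul_eq_mul, A.comm₂₁] at h21
  linear_combination -h21

/-- The derivatives of a contact transformation along `D₃`, and of its Jacobian. -/
theorem IsSymmetryMap.D₃_eq (h : A.IsSymmetryMap X Y P X' P' J') :
    A.D₃ Y = P * A.D₃ X + (A.D₁ X * A.D₂ P - A.D₂ X * A.D₁ P) ∧
    A.D₁ (A.D₁ X * A.D₂ P - A.D₂ X * A.D₁ P) = A.D₁ X * A.D₃ P - A.D₁ P * A.D₃ X ∧
    A.D₂ (A.D₁ X * A.D₂ P - A.D₂ X * A.D₁ P) = A.D₂ X * A.D₃ P - A.D₂ P * A.D₃ X := by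
  have h3 := D₃_eq_of_contact h.contact₁ h.contact₂
  refine ⟨h3, ?_, ?_⟩
  · have h31 := A.comm₃₁ Y
    rw [h.contact₁, h3, map_add] at h31
    simp only [Derivation.leibniz, smul_eq_mul, A.comm₃₁] at h31
    linear_combination -h31
  · have h32 := A.comm₃₂ Y
    rw [h.contact₂, h3, map_add] at h32
    simp only [Derivation.leibniz, smul_eq_mul, A.comm₃₂] at h32
    linear_combination -h32

/-- The pullback of `∂_y` is the contact vector field with characteristic function `1 / J`. -/
theorem IsSymmetryMap.field_inv_jacobian (h : A.IsSymmetryMap X Y P X' P' J') :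
    A.field J' X = 0 ∧ A.field J' P = 0 := by
  obtain ⟨-, h1, h2⟩ := h.D₃_eq
  have hJ := h.mul_J'
  simp only [field, derivation_inv _ hJ, h1, h2]
  constructor
  · linear_combination -J' * A.D₃ X * hJ
  · linear_combination -J' * A.D₃ P * hJ

/-- The pullback of `x ∂_x + 2 y ∂_y + p ∂_p` is the contact vector field with characteristic
function `(2 Y - X P) / J`. -/
theorem IsSymmetryMap.field_scaling (h : A.IsSymmetryMap X Y P X' P' J') :
    A.field ((2 * Y - X * P) * J') X = X ∧ A.field ((2 * Y - X * P) * J') P = P := by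
  obtain ⟨-, h1, h2⟩ := h.D₃_eq
  have hJ := h.mul_J'
  simp only [field, Derivation.leibniz, smul_eq_mul, map_sub, derivation_ofNat,
    derivation_inv _ hJ, h1, h2, h.contact₁, h.contact₂]
  constructor
  · linear_combination (X - (2 * Y - X * P) * J' * A.D₃ X) * hJ
  · linear_combination (P - (2 * Y - X * P) * J' * A.D₃ P) * hJ

end ContactFrame

/-! ### The explicit form of the symmetries -/

namespace ContactFrame

variable {R : Type*} [CommRing R] [Algebra ℂ R] {A : ContactFrame R}
variable {X Y P X' P' J' : R}

theorem eq_zero_of_mul_eq_one {S : Type*} [CommRing S] {a b c : S} (h : a * b = 1)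
    (hc : a * c = 0) : c = 0 := by
  linear_combination b * hc - c * h

/-- A symmetry maps the two-dimensional Lie algebra of infinitesimal symmetries to itself. Its
automorphisms fix the derived algebra, spanned by `∂_y`, and `x ∂_x + 2 y ∂_y + p ∂_p` modulo
`∂_y`: the Jacobian is constant, `X` and `P` do not depend on `y` and are homogeneous of degree one
in `(x, p)`. -/
theorem IsSymmetryMap.homogeneous [IsReduced R] [Nontrivial R]
    (hA : ∀ f, A.D₁ f = 0 → A.D₂ f = 0 → ∃ c : ℂ, f = algebraMap ℂ R c)
    (h : A.IsSymmetryMap X Y P X' P' J') :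
    (∃ c : ℂ, J' = algebraMap ℂ R c) ∧ A.D₃ X = 0 ∧ A.D₃ P = 0 ∧
      A.x * A.D₁ X + A.p * A.D₂ X = X ∧ A.x * A.D₁ P + A.p * A.D₂ P = P ∧
      ∃ d : ℂ, (2 * Y - X * P) * J' = algebraMap ℂ R d + (2 * A.y - A.x * A.p) := by
  obtain ⟨hX1, hP1⟩ := h.field_inv_jacobian
  obtain ⟨hX2, hP2⟩ := h.field_scaling
  obtain ⟨c₁, c₂, hc⟩ := (h.isLinearSymmetry (k := 0) (map_zero _) (map_zero _)
    (by rw [hX1, zero_mul]) (by rw [hP1, zero_mul])).exists_eq hA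
  obtain ⟨d₁, d₂, hd⟩ := (h.isLinearSymmetry (k := 1) (Derivation.map_one_eq_zero _)
    (Derivation.map_one_eq_zero _) (by rw [hX2, one_mul]) (by rw [hP2, one_mul])).exists_eq hA
  have fieldEq : ∀ (c d : ℂ) (f : R),
      A.field (algebraMap ℂ R c + algebraMap ℂ R d * (2 * A.y - A.x * A.p)) f =
        algebraMap ℂ R c * A.D₃ f + algebraMap ℂ R d *
          ((2 * A.y - A.x * A.p) * A.D₃ f + A.x * A.D₁ f + A.p * A.D₂ f) := by
    intro c d f
    simp only [field, map_add, map_sub, Derivation.leibniz, smul_eq_mul, derivation_ofNat,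
      Derivation.map_algebraMap, A.D₁x, A.D₁y, A.D₁p, A.D₂x, A.D₂y, A.D₂p]
    ring
  have hX1' := hX1
  have hP1' := hP1
  rw [hc, fieldEq] at hX1' hP1'
  rw [hd, fieldEq] at hX2 hP2
  -- the coefficient of `2 y - x p` in `1 / J` vanishes
  have hc₂ : c₂ = 0 := by
    have g1 : (algebraMap ℂ R c₁ * algebraMap ℂ R d₂ - algebraMap ℂ R c₂ * algebraMap ℂ R d₁)
        * A.D₃ X = -algebraMap ℂ R c₂ * X := by
      linear_combination algebraMap ℂ R d₂ * hX1' - algebraMap ℂ R c₂ * hX2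
    have g2 : (algebraMap ℂ R c₁ * algebraMap ℂ R d₂ - algebraMap ℂ R c₂ * algebraMap ℂ R d₁)
        * ((2 * A.y - A.x * A.p) * A.D₃ X + A.x * A.D₁ X + A.p * A.D₂ X)
        = algebraMap ℂ R c₁ * X := by
      linear_combination algebraMap ℂ R c₁ * hX2 - algebraMap ℂ R d₁ * hX1'
    have g11 := congrArg A.D₁ g1
    have g12 := congrArg A.D₂ g1
    have g13 := congrArg A.D₃ g1
    have g23 := congrArg A.D₃ g2
    simp only [map_add, map_sub, map_neg, Derivation.leibniz, smul_eq_mul, derivation_ofNat,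
      Derivation.map_algebraMap, A.D₃x, A.D₃y, A.D₃p, A.comm₃₁, A.comm₃₂] at g11 g12 g13 g23
    have g3 : 2 * (X * algebraMap ℂ R c₂) = 0 := by
      linear_combination 2 * g1 - g23 - hX1'
        + (2 * A.y - A.x * A.p) * g13 + A.x * g11 + A.p * g12
    have g4 := eq_zero_of_mul_eq_one h.mul_X' (eq_zero_of_ofNat_mul_eq_zero 2 g3)
    exact (map_eq_zero _).1 g4
  have hJ' : J' = algebraMap ℂ R c₁ := by
    rw [hc, hc₂, map_zero, zero_mul, add_zero]
  have hJ := h.mul_J'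
  have hJ₂ : J' * (A.D₁ X * A.D₂ P - A.D₂ X * A.D₁ P) = 1 := by rw [mul_comm]; exact hJ
  rw [hc₂, map_zero, zero_mul, add_zero, ← hJ'] at hX1' hP1'
  have hX3 := eq_zero_of_mul_eq_one hJ₂ hX1'
  have hP3 := eq_zero_of_mul_eq_one hJ₂ hP1'
  have hd₂ : algebraMap ℂ R d₂ = 1 := by
    have hd3 := congrArg A.D₃ hd
    rw [hJ'] at hd3
    simp only [map_add, map_sub, Derivation.leibniz, smul_eq_mul, derivation_ofNat,
      Derivation.map_algebraMap, A.D₃x, A.D₃y, A.D₃p, h.D₃_eq.1, hX3, hP3] at hd3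
    rw [← hJ'] at hd3
    have : 2 * (algebraMap ℂ R d₂ - 1) = 0 := by linear_combination -hd3 + 2 * hJ
    exact sub_eq_zero.1 (eq_zero_of_ofNat_mul_eq_zero 2 this)
  rw [hX3, hd₂] at hX2
  rw [hP3, hd₂] at hP2
  refine ⟨⟨c₁, hJ'⟩, hX3, hP3, by linear_combination hX2, by linear_combination hP2, d₁, ?_⟩
  rw [hd, hd₂, one_mul]

/-- The function `x ^ 2 - p ^ 2` is not a zero divisor: the derivative of the relation along `D₁`,
multiplied by `a`, is `2 x a ^ 2 = 0`. -/
theorem eq_zero_of_quadric_mul [IsReduced R] {a : R} (h : (A.x ^ 2 - A.p ^ 2) * a = 0) :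
    a = 0 := by
  have h1 := congrArg A.D₁ h
  simp only [map_sub, map_zero, Derivation.leibniz, Derivation.leibniz_pow, smul_eq_mul,
    nsmul_eq_mul, A.D₁x, A.D₁p] at h1
  push_cast at h1
  refine eq_zero_of_pow_eq_zero (n := 2) (eq_zero_of_ofNat_mul_eq_zero 2
    (eq_zero_of_mul_eq_one A.mul_x' ?_))
  linear_combination a * h1 - A.D₁ a * h

/-- The Jacobian matrix of a symmetry on the contact planes. As `X` and `P` are homogeneous of
degree one, the second order equations, evaluated on the Euler vector field, become first order
equations, which imply `X ^ 2 - P ^ 2 = J (x ^ 2 - p ^ 2)`; its derivatives determine the matrix. -/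
theorem IsSymmetryMap.jacobian_matrix [IsReduced R] [Nontrivial R]
    (hA : ∀ f, A.D₁ f = 0 → A.D₂ f = 0 → ∃ c : ℂ, f = algebraMap ℂ R c)
    (h : A.IsSymmetryMap X Y P X' P' J') :
    A.D₁ P = A.D₂ X ∧ A.D₂ P = A.D₁ X ∧ A.D₁ X * A.D₂ X = 0 := by
  obtain ⟨⟨c, hc⟩, hX3, hP3, hX, hP, -⟩ := h.homogeneous hA
  obtain ⟨-, hJ1, hJ2⟩ := h.D₃_eq
  rw [hX3, hP3, mul_zero, mul_zero, sub_zero] at hJ1 hJ2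
  have hJ := h.mul_J'
  have hXX := h.mul_X'
  have hPP := h.mul_P'
  have hx := A.mul_x'
  have hp := A.mul_p'
  obtain ⟨f, g, hX11, hP11, hX22, hP22, hX12, hP12⟩ := h.exists_second_derivatives
  obtain ⟨J, hJdef⟩ : ∃ J, J = A.D₁ X * A.D₂ P - A.D₂ X * A.D₁ P := ⟨_, rfl⟩
  rw [← hJdef] at hJ hJ1 hJ2
  have hX21 := A.comm₂₁ X
  have hP21 := A.comm₂₁ P
  rw [hX3] at hX21
  rw [hP3] at hP21
  have hX' := congrArg A.D₁ hX
  have hX'' := congrArg A.D₂ hX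
  have hP1 := congrArg A.D₁ hP
  have hP2 := congrArg A.D₂ hP
  have hJ1' := congrArg A.D₁ hJdef
  have hJ2' := congrArg A.D₂ hJdef
  simp only [map_add, map_sub, Derivation.leibniz, smul_eq_mul, A.D₁x, A.D₁p, A.D₂x, A.D₂p,
    hJ1, hJ2] at hX' hX'' hP1 hP2 hJ1' hJ2'
  -- the Jacobian is constant, which determines the functions `f` and `g`
  have hf : 3 * f - 2 * A.p' + 2 * A.D₁ X * P' + 2 * A.D₁ P * X' = 0 := by
    refine eq_zero_of_mul_eq_one hJ ?_
    linear_combination (3 * f - 2 * A.p' + 2 * A.D₁ X * P' + 2 * A.D₁ P * X') * hJdef - 2 * hJ1'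
      - A.D₁ X * (hP12 - hP21) - 2 * A.D₂ P * hX11 + 2 * A.D₂ X * hP11 + A.D₁ P * (hX12 - hX21)
  have hg : 3 * g - 2 * A.x' + 2 * A.D₂ X * P' + 2 * A.D₂ P * X' = 0 := by
    refine eq_zero_of_mul_eq_one hJ ?_
    linear_combination (3 * g - 2 * A.x' + 2 * A.D₂ X * P' + 2 * A.D₂ P * X') * hJdef - 2 * hJ2'
      + A.D₂ X * (hP12 + hP21) + 2 * A.D₁ X * (-hP22) + 2 * A.D₁ P * hX22
      - A.D₂ P * (hX12 + hX21)
  -- the quadratic forms of second derivatives of `X` and `P` vanish on the Euler vector field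
  have hI : X ^ 2 * P' - 2 * P + 2 * (A.x * A.p' + A.p * A.x') * X
      - 3 * A.x ^ 2 * A.p' * A.D₁ X - 3 * A.p ^ 2 * A.x' * A.D₂ X = 0 := by
    linear_combination 3 * (A.x * hX' + A.p * hX'') - 3 * A.x ^ 2 * hX11 - 3 * A.x * A.p * hX12
      - 3 * A.p ^ 2 * hX22 - 3 * P' * (A.x * A.D₁ X + A.p * A.D₂ X + X) * hX
      - 3 * (f * A.x + g * A.p) * hX - A.x * X * hf - A.p * X * hg + 2 * X * P' * hX
      + 2 * X * X' * hP + 2 * P * hXX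
  have hII : P ^ 2 * X' - 2 * X + 2 * (A.x * A.p' + A.p * A.x') * P
      - 3 * A.x ^ 2 * A.p' * A.D₁ P - 3 * A.p ^ 2 * A.x' * A.D₂ P = 0 := by
    linear_combination 3 * (A.x * hP1 + A.p * hP2) - 3 * A.x ^ 2 * hP11 - 3 * A.x * A.p * hP12
      - 3 * A.p ^ 2 * hP22 - 3 * X' * (A.x * A.D₁ P + A.p * A.D₂ P + P) * hP
      - 3 * (f * A.x + g * A.p) * hP - A.x * P * hf - A.p * P * hg + 2 * P * X' * hP
      + 2 * P * P' * hX + 2 * X * hPP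
  have h4 : A.D₁ X * P - A.D₁ P * X = A.p * J := by
    linear_combination -A.D₁ X * hP + A.D₁ P * hX - A.p * hJdef
  have h5 : X * A.D₂ P - P * A.D₂ X = A.x * J := by
    linear_combination -A.D₂ P * hX + A.D₂ X * hP - A.x * hJdef
  have hQ : X ^ 2 - P ^ 2 = J * (A.x ^ 2 - A.p ^ 2) := by
    refine sub_eq_zero.1 (eq_zero_of_ofNat_mul_eq_zero 3 ?_)
    linear_combination P * hI - X * hII - X ^ 2 * hPP + P ^ 2 * hXX
      + 3 * A.x ^ 2 * A.p' * h4 - 3 * A.p ^ 2 * A.x' * h5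
      + 3 * A.x ^ 2 * J * hp - 3 * A.p ^ 2 * J * hx
  have hQ1 := congrArg A.D₁ hQ
  have hQ2 := congrArg A.D₂ hQ
  simp only [map_sub, Derivation.leibniz, Derivation.leibniz_pow, smul_eq_mul, nsmul_eq_mul,
    A.D₁x, A.D₁p, A.D₂x, A.D₂p, hJ1, hJ2] at hQ1 hQ2
  push_cast at hQ1 hQ2
  have hQ1' : X * A.D₁ X - P * A.D₁ P = A.x * J :=
    sub_eq_zero.1 (eq_zero_of_ofNat_mul_eq_zero 2 (by linear_combination hQ1))
  have hQ2' : X * A.D₂ X - P * A.D₂ P = -A.p * J :=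
    sub_eq_zero.1 (eq_zero_of_ofNat_mul_eq_zero 2 (by linear_combination hQ2))
  have ha : (A.x ^ 2 - A.p ^ 2) * A.D₁ X = A.x * X - A.p * P := by
    refine sub_eq_zero.1 (eq_zero_of_mul_eq_one hJ ?_)
    linear_combination X * hQ1' - P * h4 - A.D₁ X * hQ
  have hb : (A.x ^ 2 - A.p ^ 2) * A.D₂ X = A.x * P - A.p * X := by
    refine sub_eq_zero.1 (eq_zero_of_mul_eq_one hJ ?_)
    linear_combination X * hQ2' + P * h5 - A.D₂ X * hQ
  have hc' : (A.x ^ 2 - A.p ^ 2) * A.D₁ P = A.x * P - A.p * X := by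
    refine sub_eq_zero.1 (eq_zero_of_mul_eq_one hJ ?_)
    linear_combination P * hQ1' - X * h4 - A.D₁ P * hQ
  have hd : (A.x ^ 2 - A.p ^ 2) * A.D₂ P = A.x * X - A.p * P := by
    refine sub_eq_zero.1 (eq_zero_of_mul_eq_one hJ ?_)
    linear_combination X * h5 + P * hQ2' - A.D₂ P * hQ
  refine ⟨sub_eq_zero.1 (eq_zero_of_quadric_mul (A := A) ?_),
    sub_eq_zero.1 (eq_zero_of_quadric_mul (A := A) ?_),
    eq_zero_of_quadric_mul (A := A) (eq_zero_of_quadric_mul (A := A) ?_)⟩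
  · linear_combination hc' - hb
  · linear_combination hd - ha
  have hI' : X ^ 2 * P' + P - A.x * A.p' * X - A.p * A.x' * X = 0 := by
    linear_combination hI + 3 * A.p' * ha + 3 * A.p * A.x' * hX - 3 * P * hp
      - 3 * A.p * A.D₁ X * hx + 3 * A.p * A.D₁ X * hp
  linear_combination (A.x ^ 2 - A.p ^ 2) * A.D₂ X * ha + (A.x * X - A.p * P) * hb
    - A.x * A.p * P * hI' + A.x * A.p * X ^ 2 * hPP - A.x ^ 2 * X * P * hp - A.p ^ 2 * X * P * hx

/-- Every symmetry is one of the maps `(a x, a ^ 2 y + b, a p)` and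
`(a p, a ^ 2 (x p - y) + b, a x)`, with complex `a` and `b`. -/
theorem IsSymmetryMap.exists_eq [IsReduced R] [Nontrivial R]
    (hA : ∀ f, A.D₁ f = 0 → A.D₂ f = 0 → ∃ c : ℂ, f = algebraMap ℂ R c)
    (h : A.IsSymmetryMap X Y P X' P' J') :
    ∃ a b : ℂ, a ≠ 0 ∧
      (X = algebraMap ℂ R a * A.x ∧ Y = algebraMap ℂ R a ^ 2 * A.y + algebraMap ℂ R b ∧
          P = algebraMap ℂ R a * A.p ∨
        X = algebraMap ℂ R a * A.p ∧
          Y = algebraMap ℂ R a ^ 2 * (A.x * A.p - A.y) + algebraMap ℂ R b ∧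
          P = algebraMap ℂ R a * A.x) := by
  obtain ⟨⟨c, hc⟩, -, -, hX, hP, d, hd⟩ := h.homogeneous hA
  obtain ⟨h1, h2, h3⟩ := h.jacobian_matrix hA
  have hJ := h.mul_J'
  rw [h1, h2] at hP
  rw [h1, h2] at hJ
  -- the entries `α`, `β` of the Jacobian matrix satisfy `α β = 0` with `α ^ 2 - β ^ 2` constant
  have const : ∀ D : Derivation ℂ R R, D (A.D₁ X) = 0 ∧ D (A.D₂ X) = 0 := by
    intro D
    have key : ∀ u v w : R, u * v = 0 → (u * u - v * v) * w = 1 → D w = 0 → D u = 0 := by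
      intro u v w h1 h2 h3
      have h4 := congrArg D h2
      have h5 := congrArg D h1
      simp only [map_sub, map_zero, Derivation.map_one_eq_zero, Derivation.leibniz, smul_eq_mul,
        h3] at h4 h5
      have h6 : u * D u - v * D v = 0 := by
        refine eq_zero_of_ofNat_mul_eq_zero 2 (eq_zero_of_mul_eq_one ((mul_comm _ _).trans h2) ?_)
        linear_combination h4
      have h7 : u * D u = 0 := by
        refine eq_zero_of_pow_eq_zero (n := 2) ?_
        linear_combination u * D u * h6 + D u * D v * h1
      have h8 := congrArg D h7
      simp only [Derivation.leibniz, smul_eq_mul, map_zero] at h8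
      refine eq_zero_of_pow_eq_zero (n := 3) ?_
      linear_combination D u * h8 - D (D u) * h7
    have hDJ : D J' = 0 := by rw [hc, Derivation.map_algebraMap]
    exact ⟨key _ _ J' h3 hJ hDJ, key _ (A.D₁ X) (-J') (by rw [mul_comm, h3])
      (by linear_combination hJ) (by rw [map_neg, hDJ, neg_zero])⟩
  obtain ⟨a, ha⟩ := hA _ (const A.D₁).1 (const A.D₂).1
  obtain ⟨b, hb⟩ := hA _ (const A.D₁).2 (const A.D₂).2
  rw [ha, hb] at h3 hX hP hJ
  have hab : a * b = 0 := by
    rw [← map_mul] at h3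
    exact (map_eq_zero _).1 h3
  have half : algebraMap ℂ R 2⁻¹ * 2 = 1 := by
    rw [← map_ofNat (algebraMap ℂ R) 2, ← map_mul, inv_mul_cancel₀ two_ne_zero, map_one]
  rcases mul_eq_zero.1 hab with h0 | h0
  · rw [h0, map_zero] at hX hP hJ
    refine ⟨b, -(2⁻¹ * b ^ 2 * d), ?_, Or.inr ⟨by linear_combination -hX, ?_,
      by linear_combination -hP⟩⟩
    · rintro rfl
      simp at hJ
    · have hY : 2 * Y - 2 * algebraMap ℂ R b ^ 2 * (A.x * A.p - A.y)
          + algebraMap ℂ R b ^ 2 * algebraMap ℂ R d = 0 := by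
        linear_combination -algebraMap ℂ R b ^ 2 * hd - (2 * Y - X * P) * hJ
          - P * hX - algebraMap ℂ R b * A.p * hP
      simp only [map_neg, map_mul, map_pow]
      linear_combination algebraMap ℂ R 2⁻¹ * hY
        - (Y - algebraMap ℂ R b ^ 2 * (A.x * A.p - A.y)) * half
  · rw [h0, map_zero] at hX hP hJ
    refine ⟨a, 2⁻¹ * a ^ 2 * d, ?_, Or.inl ⟨by linear_combination -hX, ?_,
      by linear_combination -hP⟩⟩
    · rintro rfl
      simp at hJ
    · have hY : 2 * Y - 2 * algebraMap ℂ R a ^ 2 * A.y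
          - algebraMap ℂ R a ^ 2 * algebraMap ℂ R d = 0 := by
        linear_combination algebraMap ℂ R a ^ 2 * hd - (2 * Y - X * P) * hJ
          - P * hX - algebraMap ℂ R a * A.x * hP
      simp only [map_mul, map_pow]
      linear_combination algebraMap ℂ R 2⁻¹ * hY - (Y - algebraMap ℂ R a ^ 2 * A.y) * half

end ContactFrame

/-! ### Holomorphic functions of several variables -/

open MeasureTheory Metric Set Filter Topology in
/-- Directional derivatives of holomorphic functions of several variables are holomorphic: by the
Cauchy formula they are integrals of the function over circles, which can be differentiated under
the integral sign. -/
theorem _root_.DifferentiableOn.fderiv_apply_const {E : Type*} [NormedAddCommGroup E]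
    [NormedSpace ℂ E] [FiniteDimensional ℂ E] {f : E → ℂ} {U : Set E} (hf : DifferentiableOn ℂ f U)
    (hU : IsOpen U) (v : E) : DifferentiableOn ℂ (fun z => fderiv ℂ f z v) U := by
  intro z₀ hz₀
  apply DifferentiableAt.differentiableWithinAt
  borelize E
  have : ProperSpace E := FiniteDimensional.proper ℂ E
  have hfc : ContinuousOn f U := hf.continuousOn
  -- a ball around `z₀` on which `f` is bounded
  obtain ⟨ε, hε, hball⟩ : ∃ ε > 0, ball z₀ ε ⊆ U ∩ {z | ‖f z‖ < ‖f z₀‖ + 1} := by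
    apply Metric.mem_nhds_iff.1
    refine inter_mem (hU.mem_nhds hz₀) ?_
    exact ((hfc.continuousAt (hU.mem_nhds hz₀)).norm).eventually_lt continuousAt_const (by simp)
  have hd : ∀ z ∈ ball z₀ ε, DifferentiableAt ℂ f z := fun z hz =>
    hf.differentiableAt (hU.mem_nhds (hball hz).1)
  obtain ⟨R, hR, hRε⟩ : ∃ R > 0, 3 * R = ε := ⟨ε / 3, by positivity, by ring⟩
  obtain ⟨r, hr, hrv⟩ : ∃ r > 0, r * ‖v‖ < R := by
    refine ⟨R / (‖v‖ + 1), by positivity, ?_⟩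
    rw [div_mul_eq_mul_div, div_lt_iff₀ (by positivity)]
    nlinarith [norm_nonneg v]
  have hmem : ∀ z ∈ ball z₀ R, ∀ ζ : ℂ, ‖ζ‖ ≤ r → z + ζ • v ∈ ball z₀ (2 * R) := by
    intro z hz ζ hζ
    rw [mem_ball, dist_eq_norm] at hz ⊢
    calc ‖z + ζ • v - z₀‖ = ‖(z - z₀) + ζ • v‖ := by congr 1; abel
      _ ≤ ‖z - z₀‖ + ‖ζ • v‖ := norm_add_le _ _
      _ < 2 * R := by
        rw [norm_smul]
        nlinarith [mul_le_mul_of_nonneg_right hζ (norm_nonneg v)]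
  have hsub : ball z₀ (2 * R) ⊆ ball z₀ ε := ball_subset_ball (by linarith)
  -- the Cauchy estimate for the derivative
  have hbound : ∀ w ∈ ball z₀ (2 * R), ‖fderiv ℂ f w‖ ≤ 2 * (‖f z₀‖ + 1) / R := by
    intro w hw
    have hws : ball w R ⊆ ball z₀ ε := fun u hu => by
      rw [mem_ball] at *
      linarith [dist_triangle u w z₀]
    refine Complex.norm_fderiv_le_div_of_mapsTo_ball (fun u hu =>
      (hd u (hws hu)).differentiableWithinAt) (fun u hu => ?_) hR
    have h1 : ‖f u‖ < _ := (hball (hws hu)).2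
    have h2 : ‖f w‖ < _ := (hball (hsub hw)).2
    rw [mem_closedBall, dist_eq_norm]
    linarith [norm_sub_le (f u) (f w)]
  set c : ℝ → ℂ := circleMap 0 r with hc
  have hcn : ∀ θ, ‖c θ‖ = r := fun θ => by simp [hc, abs_of_pos hr]
  have hcc : Continuous c := continuous_circleMap 0 r
  -- the Cauchy kernel for the derivative along the complex line in the direction `v`
  set k : ℝ → ℂ := fun θ => deriv c θ * (1 / (c θ - 0) ^ 2) with hk
  have hkc : Continuous k := by
    have h0 : ∀ θ, c θ ≠ 0 := fun θ h => by have := hcn θ; rw [h, norm_zero] at this; linarith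
    have : deriv c = fun θ => circleMap 0 r θ * Complex.I := by
      ext θ; simp [hc]
    rw [hk, this]
    refine (hcc.mul continuous_const).mul (continuous_const.div (by fun_prop) fun θ => ?_)
    simpa using h0 θ
  have hformula : ∀ z ∈ ball z₀ R, (2 * Real.pi * Complex.I) * fderiv ℂ f z v =
      ∫ θ in Ioc 0 (2 * Real.pi), k θ * f (z + c θ • v) := by
    intro z hz
    have hline : ∀ ζ : ℂ, ‖ζ‖ ≤ r →
        HasDerivAt (fun ζ : ℂ => f (z + ζ • v)) (fderiv ℂ f (z + ζ • v) v) ζ := by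
      intro ζ hζ
      have h1 : HasDerivAt (fun ζ : ℂ => z + ζ • v) v ζ := by
        simpa using ((hasDerivAt_id ζ).smul_const v).const_add z
      exact ((hd _ (hsub (hmem z hz ζ hζ))).hasFDerivAt).comp_hasDerivAt ζ h1
    have h2 := DifferentiableOn.deriv_eq_smul_circleIntegral (c := (0 : ℂ))
      (f := fun ζ : ℂ => f (z + ζ • v)) hr fun ζ hζ =>
        (hline ζ (by simpa using hζ)).differentiableAt.differentiableWithinAt
    rw [(hline 0 (by simpa using hr.le)).deriv] at h2
    simp only [zero_smul, add_zero, smul_eq_mul] at h2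
    rw [← h2, circleIntegral, intervalIntegral.integral_of_le Real.two_pi_pos.le]
    refine integral_congr_ae (Eventually.of_forall fun θ => ?_)
    simp only [smul_eq_mul, hk, hc]
    ring
  have hcont : ∀ z ∈ ball z₀ R, Continuous fun θ => f (z + c θ • v) := by
    intro z hz
    rw [continuous_iff_continuousAt]
    intro θ
    exact (hd _ (hsub (hmem z hz _ (hcn θ).le))).continuousAt.comp
      (f := fun θ => z + c θ • v) (by fun_prop)
  have hz₀R : z₀ ∈ ball z₀ R := mem_ball_self hR
  have hint := hasFDerivAt_integral_of_dominated_of_fderiv_le (𝕜 := ℂ)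
    (μ := volume.restrict (Ioc 0 (2 * Real.pi)))
    (F := fun z θ => k θ * f (z + c θ • v)) (x₀ := z₀)
    (F' := fun z θ => k θ • fderiv ℂ f (z + c θ • v))
    (bound := fun θ => ‖k θ‖ * (2 * (‖f z₀‖ + 1) / R))
    (ball_mem_nhds z₀ hR)
    (eventually_of_mem (ball_mem_nhds z₀ hR) fun z hz =>
      (hkc.mul (hcont z hz)).aestronglyMeasurable)
    ((hkc.mul (hcont z₀ hz₀R)).integrableOn_Ioc)
    (by
      refine hkc.aestronglyMeasurable.smul ?_
      have hm : Measurable fun θ => fderiv ℂ f (z₀ + c θ • v) :=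
        (measurable_fderiv ℂ f).comp (by fun_prop : Continuous fun θ => z₀ + c θ • v).measurable
      exact hm.aestronglyMeasurable)
    (Eventually.of_forall fun θ z hz => by
      rw [norm_smul]
      exact mul_le_mul_of_nonneg_left (hbound _ (hmem z hz _ (hcn θ).le)) (norm_nonneg _))
    ((hkc.norm.mul continuous_const).integrableOn_Ioc)
    (Eventually.of_forall fun θ z hz => by
      have h1 : HasFDerivAt (fun z => z + c θ • v) (ContinuousLinearMap.id ℂ E) z :=
        (hasFDerivAt_id z).add_const _
      exact (((hd _ (hsub (hmem z hz _ (hcn θ).le))).hasFDerivAt).comp z h1).const_mul (k θ))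
  have h0 : (2 * Real.pi * Complex.I : ℂ) ≠ 0 := by simp [Real.pi_ne_zero]
  have heq : (fun z => fderiv ℂ f z v) =ᶠ[𝓝 z₀] fun z => (2 * Real.pi * Complex.I)⁻¹ *
      ∫ θ in Ioc 0 (2 * Real.pi), k θ * f (z + c θ • v) := by
    filter_upwards [ball_mem_nhds z₀ hR] with z hz
    rw [← hformula z hz, inv_mul_cancel_left₀ h0]
  exact (hint.differentiableAt.const_mul _).congr_of_eventuallyEq heq

theorem clm_J1_apply (L : J1 →L[ℂ] ℂ) (v : J1) :
    L v = v.1 * L (1, 0, 0) + v.2.1 * L (0, 1, 0) + v.2.2 * L (0, 0, 1) := by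
  have : v = v.1 • ((1, 0, 0) : J1) + v.2.1 • ((0, 1, 0) : J1) + v.2.2 • ((0, 0, 1) : J1) := by
    ext <;> simp
  conv_lhs => rw [this]
  simp only [map_add, map_smul, smul_eq_mul]

theorem differentiableOn_fderiv {f : J1 → ℂ} {U : Set J1} (hf : DifferentiableOn ℂ f U)
    (hU : IsOpen U) : DifferentiableOn ℂ (fderiv ℂ f) U := by
  have h : fderiv ℂ f = fun z => fderiv ℂ f z (1, 0, 0) • ContinuousLinearMap.fst ℂ ℂ (ℂ × ℂ)
      + fderiv ℂ f z (0, 1, 0) •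
        (ContinuousLinearMap.fst ℂ ℂ ℂ).comp (ContinuousLinearMap.snd ℂ ℂ (ℂ × ℂ))
      + fderiv ℂ f z (0, 0, 1) •
        (ContinuousLinearMap.snd ℂ ℂ ℂ).comp (ContinuousLinearMap.snd ℂ ℂ (ℂ × ℂ)) := by
    funext z
    apply ContinuousLinearMap.ext
    intro v
    rw [clm_J1_apply]
    simp [mul_comm]
  rw [h]
  exact (((hf.fderiv_apply_const hU _).smul_const _).add
    ((hf.fderiv_apply_const hU _).smul_const _)).add ((hf.fderiv_apply_const hU _).smul_const _)

/-- The mixed second derivatives of a holomorphic function agree. -/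
theorem fderiv_fderiv_comm {f : J1 → ℂ} {U : Set J1} (hf : DifferentiableOn ℂ f U)
    (hU : IsOpen U) {z : J1} (hz : z ∈ U) (v w : J1) :
    fderiv ℂ (fun z => fderiv ℂ f z v) z w = fderiv ℂ (fun z => fderiv ℂ f z w) z v := by
  have hd : DifferentiableAt ℂ (fderiv ℂ f) z :=
    (differentiableOn_fderiv hf hU).differentiableAt (hU.mem_nhds hz)
  have h := second_derivative_symmetric_of_eventually (𝕜 := ℂ)
    (eventually_of_mem (hU.mem_nhds hz) fun y hy =>
      (hf.differentiableAt (hU.mem_nhds hy)).hasFDerivAt) hd.hasFDerivAt v w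
  have key : ∀ u : J1, fderiv ℂ (fun z => fderiv ℂ f z u) z =
      (ContinuousLinearMap.apply ℂ ℂ u).comp (fderiv ℂ (fderiv ℂ f) z) := fun u =>
    ((ContinuousLinearMap.apply ℂ ℂ u).hasFDerivAt.comp z hd.hasFDerivAt).fderiv
  rw [key, key]
  exact h.symm

/-! ### The ring of holomorphic functions -/

/-- The extension by zero of a function on `U`. -/
noncomputable def extendZero {U : Set J1} (f : U → ℂ) : J1 → ℂ := Function.extend (↑) f 0

theorem extendZero_apply {U : Set J1} (f : U → ℂ) {z : J1} (hz : z ∈ U) :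
    extendZero f z = f ⟨z, hz⟩ :=
  Subtype.val_injective.extend_apply f 0 ⟨z, hz⟩

/-- The algebra of holomorphic functions on `U`. Its elements are functions on the subtype, so that
equal functions are equal elements; derivatives are those of the extension by zero. -/
def Hol (U : Set J1) : Subalgebra ℂ (U → ℂ) where
  carrier := {f | DifferentiableOn ℂ (extendZero f) U}
  mul_mem' {f g} hf hg := (DifferentiableOn.mul hf hg).congr fun z hz => by
    simp [extendZero_apply _ hz]
  add_mem' {f g} hf hg := (DifferentiableOn.add hf hg).congr fun z hz => by
    simp [extendZero_apply _ hz]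
  algebraMap_mem' c := (differentiableOn_const c).congr fun z hz => by
    simp [extendZero_apply _ hz]

variable {U : Set J1}

/-- The restriction to `U` of a function that is holomorphic on `U`. -/
def Hol.mk (F : J1 → ℂ) (hF : DifferentiableOn ℂ F U) : Hol U :=
  ⟨fun z => F z, hF.congr fun _ hz => extendZero_apply _ hz⟩

/-- The partial derivative of a holomorphic function on `U` in the direction `v`. -/
noncomputable def Hol.partial (hU : IsOpen U) (v : J1) (f : Hol U) : Hol U :=
  Hol.mk (fun z => fderiv ℂ (extendZero f.1) z v) (DifferentiableOn.fderiv_apply_const f.2 hU v)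

theorem Hol.partial_apply (hU : IsOpen U) (v : J1) (f : Hol U) (z : U) :
    (Hol.partial hU v f).1 z = fderiv ℂ (extendZero f.1) z v := rfl

theorem Hol.hasFDerivAt (hU : IsOpen U) (f : Hol U) {z : J1} (hz : z ∈ U) :
    HasFDerivAt (extendZero f.1) (fderiv ℂ (extendZero f.1) z) z :=
  (DifferentiableOn.differentiableAt f.2 (hU.mem_nhds hz)).hasFDerivAt

theorem fderiv_extendZero_congr (hU : IsOpen U) {f : U → ℂ} {F : J1 → ℂ}
    (h : ∀ z : U, f z = F z) {z : J1} (hz : z ∈ U) :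
    fderiv ℂ (extendZero f) z = fderiv ℂ F z :=
  Filter.EventuallyEq.fderiv_eq (eventually_of_mem (hU.mem_nhds hz) fun y hy => by
    rw [extendZero_apply _ hy, h])

/-- Differentiation in the direction `v`, as a derivation of the ring of holomorphic functions. -/
noncomputable def Hol.derivation (hU : IsOpen U) (v : J1) : Derivation ℂ (Hol U) (Hol U) :=
  Derivation.mk'
    { toFun := Hol.partial hU v
      map_add' := fun f g => by
        ext z
        have h := fderiv_extendZero_congr hU (f := (f + g).1)
          (F := extendZero f.1 + extendZero g.1)
          (fun z => by simp [extendZero_apply _ z.2]) z.2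
        rw [Hol.partial_apply, h,
          ((Hol.hasFDerivAt hU f z.2).add (Hol.hasFDerivAt hU g z.2)).fderiv]
        rfl
      map_smul' := fun c f => by
        ext z
        have h := fderiv_extendZero_congr hU (f := (c • f).1)
          (F := c • extendZero f.1) (fun z => by simp [extendZero_apply _ z.2]) z.2
        rw [Hol.partial_apply, h, ((Hol.hasFDerivAt hU f z.2).const_smul c).fderiv]
        rfl }
    (fun f g => by
      ext z
      have h := fderiv_extendZero_congr hU (f := (f * g).1)
        (F := extendZero f.1 * extendZero g.1) (fun z => by simp [extendZero_apply _ z.2]) z.2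
      change (Hol.partial hU v (f * g)).1 z = _
      rw [Hol.partial_apply, h, ((Hol.hasFDerivAt hU f z.2).mul (Hol.hasFDerivAt hU g z.2)).fderiv]
      simp [extendZero_apply _ z.2]
      rfl)

theorem Hol.derivation_apply (hU : IsOpen U) (v : J1) (f : Hol U) (z : U) :
    (Hol.derivation hU v f).1 z = fderiv ℂ (extendZero f.1) z v := rfl

theorem Hol.derivation_mk (hU : IsOpen U) (v : J1) {F : J1 → ℂ} (hF : DifferentiableOn ℂ F U)
    (z : U) : (Hol.derivation hU v (Hol.mk F hF)).1 z = fderiv ℂ F z v := by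
  rw [Hol.derivation_apply,
    fderiv_extendZero_congr hU (f := (Hol.mk F hF).1) (F := F) (fun _ => rfl) z.2]

theorem Hol.derivation_comm (hU : IsOpen U) (v w : J1) (f : Hol U) :
    Hol.derivation hU v (Hol.derivation hU w f) = Hol.derivation hU w (Hol.derivation hU v f) := by
  ext z
  have h : ∀ u u' : J1, (Hol.derivation hU u (Hol.derivation hU u' f)).1 z =
      fderiv ℂ (fun z => fderiv ℂ (extendZero f.1) z u') z u := fun u u' =>
    Hol.derivation_mk hU u _ z
  rw [h, h, fderiv_fderiv_comm f.2 hU z.2]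

instance : IsReduced (Hol U) :=
  isReduced_of_injective (Hol U).val Subtype.val_injective

theorem Hol.nontrivial (hU : U.Nonempty) : Nontrivial (Hol U) := by
  obtain ⟨z, hz⟩ := hU
  refine ⟨0, 1, fun h => ?_⟩
  have := congrArg (fun f : Hol U => f.1 ⟨z, hz⟩) h
  simp at this

/-- The inverse of a holomorphic function without zeros. -/
noncomputable def Hol.inv (f : Hol U) (hf : ∀ z, f.1 z ≠ 0) : Hol U :=
  Hol.mk (fun z => (extendZero f.1 z)⁻¹) (DifferentiableOn.inv f.2 fun z hz => by
    rw [extendZero_apply _ hz]; exact hf _)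

theorem Hol.inv_apply (f : Hol U) (hf : ∀ z, f.1 z ≠ 0) (z : U) :
    (Hol.inv f hf).1 z = (f.1 z)⁻¹ :=
  congrArg (·⁻¹) (extendZero_apply f.1 z.2)

theorem Hol.mul_inv (f : Hol U) (hf : ∀ z, f.1 z ≠ 0) : f * Hol.inv f hf = 1 := by
  ext z
  change f.1 z * (Hol.inv f hf).1 z = 1
  rw [Hol.inv_apply, mul_inv_cancel₀ (hf z)]

/-- The coordinate `x`, as a holomorphic function on `U`. -/
def Hol.x (U : Set J1) : Hol U := Hol.mk (fun z => z.1) (by fun_prop)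

/-- The coordinate `y`, as a holomorphic function on `U`. -/
def Hol.y (U : Set J1) : Hol U := Hol.mk (fun z => z.2.1) (by fun_prop)

/-- The coordinate `p`, as a holomorphic function on `U`. -/
def Hol.p (U : Set J1) : Hol U := Hol.mk (fun z => z.2.2) (by fun_prop)

theorem Hol.derivation_x (hU : IsOpen U) (v : J1) :
    Hol.derivation hU v (Hol.x U) = algebraMap ℂ _ v.1 := by
  ext z
  rw [Hol.x, Hol.derivation_mk, (hasFDerivAt_fst (𝕜 := ℂ)).fderiv]
  rfl

theorem Hol.derivation_y (hU : IsOpen U) (v : J1) :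
    Hol.derivation hU v (Hol.y U) = algebraMap ℂ _ v.2.1 := by
  ext z
  rw [Hol.y, Hol.derivation_mk, (hasFDerivAt_snd (𝕜 := ℂ)).fst.fderiv]
  rfl

theorem Hol.derivation_p (hU : IsOpen U) (v : J1) :
    Hol.derivation hU v (Hol.p U) = algebraMap ℂ _ v.2.2 := by
  ext z
  rw [Hol.p, Hol.derivation_mk, (hasFDerivAt_snd (𝕜 := ℂ)).snd.fderiv]
  rfl

/-- The contact frame `∂_x + p ∂_y`, `∂_p`, `∂_y` on the holomorphic functions on `U`. -/
noncomputable def Hol.frame (hU : IsOpen U) (hd : U ⊆ dom) : ContactFrame (Hol U) where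
  D₁ := Hol.derivation hU (1, 0, 0) + Hol.p U • Hol.derivation hU (0, 1, 0)
  D₂ := Hol.derivation hU (0, 0, 1)
  D₃ := Hol.derivation hU (0, 1, 0)
  x := Hol.x U
  y := Hol.y U
  p := Hol.p U
  x' := Hol.inv (Hol.x U) fun z => (hd z.2).1
  p' := Hol.inv (Hol.p U) fun z => (hd z.2).2
  mul_x' := Hol.mul_inv _ _
  mul_p' := Hol.mul_inv _ _
  comm₂₁ f := by
    simp [Hol.derivation_p, Hol.derivation_comm hU (0, 0, 1)]
    ring
  comm₃₁ f := by
    simp [Hol.derivation_p, Hol.derivation_comm hU (0, 1, 0)]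
  comm₃₂ f := Hol.derivation_comm hU _ _ f
  D₁x := by simp [Hol.derivation_x]
  D₁y := by simp [Hol.derivation_y]
  D₁p := by simp [Hol.derivation_p]
  D₂x := by simp [Hol.derivation_x]
  D₂y := by simp [Hol.derivation_y]
  D₂p := by simp [Hol.derivation_p]
  D₃x := by simp [Hol.derivation_x]
  D₃y := by simp [Hol.derivation_y]
  D₃p := by simp [Hol.derivation_p]

/-- On a connected open set, the constants of the frame are the complex numbers: a function
killed by `D₁` and `D₂` is killed by their commutator `D₃` as well. -/
theorem Hol.exists_eq_algebraMap (hU : IsOpen U) (hd : U ⊆ dom) (hc : IsPreconnected U)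
    (f : Hol U) (h₁ : (Hol.frame hU hd).D₁ f = 0) (h₂ : (Hol.frame hU hd).D₂ f = 0) :
    ∃ c : ℂ, f = algebraMap ℂ (Hol U) c := by
  have h₃ : (Hol.frame hU hd).D₃ f = 0 := by
    have := (Hol.frame hU hd).comm₂₁ f
    rw [h₁, h₂, map_zero, map_zero, zero_add] at this
    exact this.symm
  have h₁' : Hol.derivation hU (1, 0, 0) f = 0 := by
    have h : (Hol.frame hU hd).D₁ f =
      Hol.derivation hU (1, 0, 0) f + Hol.p U * (Hol.frame hU hd).D₃ f := rfl
    rw [h₁, h₃, mul_zero, add_zero] at h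
    exact h.symm
  obtain ⟨c, hc⟩ := hU.exists_is_const_of_fderiv_eq_zero (𝕜 := ℂ) hc f.2 fun z hz => by
    apply ContinuousLinearMap.ext
    intro v
    have e : ∀ w : J1, Hol.derivation hU w f = 0 → fderiv ℂ (extendZero f.1) z w = 0 :=
      fun w hw => congrArg (fun g : Hol U => g.1 ⟨z, hz⟩) hw
    rw [clm_J1_apply, e _ h₁', e _ h₃, e _ h₂]
    simp
  refine ⟨c, ?_⟩
  ext z
  have := hc z z.2
  rw [extendZero_apply _ z.2] at this
  exact this

/-! ### Total derivatives of holomorphic functions -/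

theorem Hol.frame_D₁_apply (hU : IsOpen U) (hd : U ⊆ dom) (f : Hol U) {z : J1} (hz : z ∈ U) :
    ((Hol.frame hU hd).D₁ f).1 ⟨z, hz⟩ =
      fderiv ℂ (extendZero f.1) z (1, 0, 0) + z.2.2 * fderiv ℂ (extendZero f.1) z (0, 1, 0) := rfl

theorem Hol.frame_D₂_apply (hU : IsOpen U) (hd : U ⊆ dom) (f : Hol U) {z : J1} (hz : z ∈ U) :
    ((Hol.frame hU hd).D₂ f).1 ⟨z, hz⟩ = fderiv ℂ (extendZero f.1) z (0, 0, 1) := rfl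

/-- Evaluation at a point. -/
def Hol.eval (z : U) : Hol U →+* ℂ :=
  (Pi.evalRingHom (fun _ : U => ℂ) z).comp (Hol U).val.toRingHom

theorem Hol.ext_eval {f g : Hol U} (h : ∀ z, Hol.eval z f = Hol.eval z g) : f = g :=
  Subtype.ext (funext h)

theorem Hol.frame_x'_apply (hU : IsOpen U) (hd : U ⊆ dom) (z : U) :
    (Hol.frame hU hd).x'.1 z = z.1.1⁻¹ := Hol.inv_apply (Hol.x U) (fun z => (hd z.2).1) z

theorem Hol.frame_p'_apply (hU : IsOpen U) (hd : U ⊆ dom) (z : U) :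
    (Hol.frame hU hd).p'.1 z = z.1.2.2⁻¹ := Hol.inv_apply (Hol.p U) (fun z => (hd z.2).2) z

/-- The derivative along a vector that is tangent to the contact distribution. -/
theorem Hol.fderiv_contact (hU : IsOpen U) (hd : U ⊆ dom) (f : Hol U) {z : J1} (hz : z ∈ U)
    (q : ℂ) : fderiv ℂ (extendZero f.1) z (1, z.2.2, q) =
      ((Hol.frame hU hd).D₁ f).1 ⟨z, hz⟩ + q * ((Hol.frame hU hd).D₂ f).1 ⟨z, hz⟩ := by
  rw [clm_J1_apply, Hol.frame_D₁_apply, Hol.frame_D₂_apply]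
  ring

theorem totalD1_eq (hU : IsOpen U) (hd : U ⊆ dom) {F : J1 → ℂ} (hF : DifferentiableOn ℂ F U)
    {w : J2} (hw : (w.1, w.2.1, w.2.2.1) ∈ U) :
    totalD1 F w = extendZero ((Hol.frame hU hd).D₁ (Hol.mk F hF)).1 (w.1, w.2.1, w.2.2.1) +
      w.2.2.2 * extendZero ((Hol.frame hU hd).D₂ (Hol.mk F hF)).1 (w.1, w.2.1, w.2.2.1) := by
  rw [extendZero_apply _ hw, extendZero_apply _ hw, ← Hol.fderiv_contact, totalD1,
    fderiv_extendZero_congr hU (f := (Hol.mk F hF).1) (F := F) (fun _ => rfl) hw]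

theorem partialP_eq (hU : IsOpen U) (hd : U ⊆ dom) {F : J1 → ℂ} (hF : DifferentiableOn ℂ F U)
    {z : J1} (hz : z ∈ U) :
    partialP F z = ((Hol.frame hU hd).D₂ (Hol.mk F hF)).1 ⟨z, hz⟩ := by
  rw [Hol.frame_D₂_apply, partialP,
    fderiv_extendZero_congr hU (f := (Hol.mk F hF).1) (F := F) (fun _ => rfl) hz]

theorem partialX_add_eq (hU : IsOpen U) (hd : U ⊆ dom) {F : J1 → ℂ} (hF : DifferentiableOn ℂ F U)
    {z : J1} (hz : z ∈ U) :
    partialX F z + z.2.2 * partialY F z = ((Hol.frame hU hd).D₁ (Hol.mk F hF)).1 ⟨z, hz⟩ := by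
  rw [Hol.frame_D₁_apply, partialX, partialY,
    fderiv_extendZero_congr hU (f := (Hol.mk F hF).1) (F := F) (fun _ => rfl) hz]

/-- The projection of second jets to first jets. -/
noncomputable def proj₂ : J2 →L[ℂ] J1 :=
  (ContinuousLinearMap.fst ℂ _ _).prod
    (((ContinuousLinearMap.fst ℂ _ _).comp (ContinuousLinearMap.snd ℂ _ _)).prod
      ((ContinuousLinearMap.fst ℂ _ _).comp
        ((ContinuousLinearMap.snd ℂ _ _).comp (ContinuousLinearMap.snd ℂ _ _))))

/-- The projection of third jets to first jets. -/
noncomputable def proj₃ : J3 →L[ℂ] J1 :=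
  (ContinuousLinearMap.fst ℂ _ _).prod
    (((ContinuousLinearMap.fst ℂ _ _).comp (ContinuousLinearMap.snd ℂ _ _)).prod
      ((ContinuousLinearMap.fst ℂ _ _).comp
        ((ContinuousLinearMap.snd ℂ _ _).comp (ContinuousLinearMap.snd ℂ _ _))))

/-- The coordinate `q` on second jets. -/
noncomputable def coordQ₂ : J2 →L[ℂ] ℂ :=
  (ContinuousLinearMap.snd ℂ _ _).comp
    ((ContinuousLinearMap.snd ℂ _ _).comp (ContinuousLinearMap.snd ℂ _ _))

/-- The coordinate `q` on third jets. -/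
noncomputable def coordQ₃ : J3 →L[ℂ] ℂ :=
  (ContinuousLinearMap.fst ℂ _ _).comp ((ContinuousLinearMap.snd ℂ _ _).comp
    ((ContinuousLinearMap.snd ℂ _ _).comp (ContinuousLinearMap.snd ℂ _ _)))

/-- The coordinate `r` on third jets. -/
noncomputable def coordR₃ : J3 →L[ℂ] ℂ :=
  (ContinuousLinearMap.snd ℂ _ _).comp ((ContinuousLinearMap.snd ℂ _ _).comp
    ((ContinuousLinearMap.snd ℂ _ _).comp (ContinuousLinearMap.snd ℂ _ _)))

theorem hasFDerivAt_lift {E : Type*} [NormedAddCommGroup E] [NormedSpace ℂ E] (hU : IsOpen U)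
    (f : Hol U) (π : E →L[ℂ] J1) {w : E} (hw : π w ∈ U) :
    HasFDerivAt (fun w => extendZero f.1 (π w)) ((fderiv ℂ (extendZero f.1) (π w)).comp π) w :=
  (Hol.hasFDerivAt hU f hw).comp w π.hasFDerivAt

theorem isOpen_preimage_proj₂ (hU : IsOpen U) : IsOpen {w : J2 | (w.1, w.2.1, w.2.2.1) ∈ U} :=
  hU.preimage proj₂.continuous

theorem isOpen_preimage_proj₃ (hU : IsOpen U) : IsOpen {w : J3 | (w.1, w.2.1, w.2.2.1) ∈ U} :=
  hU.preimage proj₃.continuous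

/-- The total derivative of a function `a + q b` of second jets, where `a` and `b` are functions of
first jets. -/
theorem hasFDerivAt_affine (hU : IsOpen U) (hd : U ⊆ dom) (a b : Hol U) {w : J2}
    (hw : (w.1, w.2.1, w.2.2.1) ∈ U) :
    ∃ L : J2 →L[ℂ] ℂ, HasFDerivAt (fun w : J2 => extendZero a.1 (w.1, w.2.1, w.2.2.1)
        + w.2.2.2 * extendZero b.1 (w.1, w.2.1, w.2.2.1)) L w ∧
      ∀ r, L (1, w.2.2.1, w.2.2.2, r) =
        ((Hol.frame hU hd).D₁ a).1 ⟨_, hw⟩ + w.2.2.2 * ((Hol.frame hU hd).D₂ a).1 ⟨_, hw⟩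
        + w.2.2.2 * (((Hol.frame hU hd).D₁ b).1 ⟨_, hw⟩
          + w.2.2.2 * ((Hol.frame hU hd).D₂ b).1 ⟨_, hw⟩) + r * b.1 ⟨_, hw⟩ := by
  have hq : HasFDerivAt (fun w : J2 => w.2.2.2) coordQ₂ w := coordQ₂.hasFDerivAt
  refine ⟨_, (hasFDerivAt_lift hU a proj₂ hw).add (hq.mul (hasFDerivAt_lift hU b proj₂ hw)), ?_⟩
  intro r
  have e := Hol.fderiv_contact hU hd a hw w.2.2.2
  have e' := Hol.fderiv_contact hU hd b hw w.2.2.2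
  have h := extendZero_apply b.1 hw
  change fderiv ℂ (extendZero a.1) (w.1, w.2.1, w.2.2.1) (1, w.2.2.1, w.2.2.2)
    + (w.2.2.2 * fderiv ℂ (extendZero b.1) (w.1, w.2.1, w.2.2.1) (1, w.2.2.1, w.2.2.2)
      + extendZero b.1 (w.1, w.2.1, w.2.2.1) * r) = _
  rw [e, e', h]
  ring

theorem cubic_eq_zero {c₀ c₁ c₂ c₃ : ℂ} (h : ∀ q : ℂ, c₀ + q * c₁ + q ^ 2 * c₂ + q ^ 3 * c₃ = 0) :
    c₀ = 0 ∧ c₁ = 0 ∧ c₂ = 0 ∧ c₃ = 0 := by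
  have h0 := h 0
  have h1 := h 1
  have h2 := h (-1)
  have h3 := h 2
  refine ⟨by linear_combination h0, ?_, ?_, ?_⟩
  · linear_combination (-1 / 2) * h0 + h1 - (1 / 3) * h2 - (1 / 6) * h3
  · linear_combination -h0 + (1 / 2) * h1 + (1 / 2) * h2
  · linear_combination (1 / 2) * h0 - (1 / 2) * h1 - (1 / 6) * h2 + (1 / 6) * h3

/-- A cubic polynomial that vanishes wherever a nonzero polynomial of degree one does not is
zero. -/
theorem cubic_eq_zero_of_ne {a b c₀ c₁ c₂ c₃ : ℂ} (hab : a ≠ 0 ∨ b ≠ 0)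
    (h : ∀ q : ℂ, a + q * b ≠ 0 → c₀ + q * c₁ + q ^ 2 * c₂ + q ^ 3 * c₃ = 0) :
    c₀ = 0 ∧ c₁ = 0 ∧ c₂ = 0 ∧ c₃ = 0 := by
  have hc : Continuous fun q : ℂ => c₀ + q * c₁ + q ^ 2 * c₂ + q ^ 3 * c₃ := by fun_prop
  have hfin : {q : ℂ | a + q * b = 0}.Finite := by
    refine Set.Subsingleton.finite fun q hq q' hq' => ?_
    have hb : b ≠ 0 := by
      rintro rfl
      simp at hab hq
      exact hab hq
    exact mul_right_cancel₀ hb (add_left_cancel (hq.trans hq'.symm))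
  have hdense : Dense {q : ℂ | a + q * b = 0}ᶜ := hfin.countable.dense_compl ℂ
  refine cubic_eq_zero fun q => ?_
  exact congrFun (hc.ext_on hdense continuous_const fun q hq => h q hq) q

theorem isOpen_dom : IsOpen dom :=
  (isOpen_ne_fun continuous_fst continuous_const).inter
    (isOpen_ne_fun (continuous_snd.comp continuous_snd) continuous_const)

theorem fderiv_omega_apply {w : J2} (hx : w.1 ≠ 0) (hp : w.2.2.1 ≠ 0) (v : J2) :
    fderiv ℂ omega w v = -(w.2.2.2 ^ 2 / w.1 ^ 2) * v.1 + w.2.2.2 / w.2.2.1 ^ 2 * v.2.2.1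
      + (2 * w.2.2.2 / w.1 - 1 / w.2.2.1) * v.2.2.2 := by
  have h1 : HasFDerivAt (fun w : J2 => w.1) (ContinuousLinearMap.fst ℂ ℂ (ℂ × ℂ × ℂ)) w :=
    hasFDerivAt_fst
  have h3 : HasFDerivAt (fun w : J2 => w.2.2.1) ((ContinuousLinearMap.fst ℂ ℂ ℂ).comp
      ((ContinuousLinearMap.snd ℂ ℂ (ℂ × ℂ)).comp (ContinuousLinearMap.snd ℂ ℂ (ℂ × ℂ × ℂ)))) w :=
    ((ContinuousLinearMap.fst ℂ ℂ ℂ).comp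
      ((ContinuousLinearMap.snd ℂ ℂ (ℂ × ℂ)).comp
        (ContinuousLinearMap.snd ℂ ℂ (ℂ × ℂ × ℂ)))).hasFDerivAt
  have h4 : HasFDerivAt (fun w : J2 => w.2.2.2) coordQ₂ w := coordQ₂.hasFDerivAt
  have h := ((h4.pow 2).mul (hasFDerivAt_inv hx |>.comp w h1)).sub
    (h4.mul (hasFDerivAt_inv hp |>.comp w h3))
  have e : omega = (fun w : J2 => w.2.2.2 ^ 2 * w.1⁻¹ - w.2.2.2 * w.2.2.1⁻¹) := by
    funext w
    rw [omega, div_eq_mul_inv, div_eq_mul_inv]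
  have h' : HasFDerivAt (fun w : J2 => w.2.2.2 ^ 2 * w.1⁻¹ - w.2.2.2 * w.2.2.1⁻¹) _ w := h
  rw [e, h'.fderiv]
  simp [coordQ₂]
  field_simp
  ring

theorem totalD2_totalD1 (hU : IsOpen U) (hd : U ⊆ dom) {F : J1 → ℂ}
    (hF : DifferentiableOn ℂ F U) {w : J3} (hw : (w.1, w.2.1, w.2.2.1) ∈ U) :
    totalD2 (totalD1 F) w =
      let A := Hol.frame hU hd
      let f := Hol.mk F hF
      extendZero (A.D₁ (A.D₁ f)).1 (w.1, w.2.1, w.2.2.1)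
      + w.2.2.2.1 * extendZero (A.D₂ (A.D₁ f) + A.D₁ (A.D₂ f)).1 (w.1, w.2.1, w.2.2.1)
      + w.2.2.2.1 ^ 2 * extendZero (A.D₂ (A.D₂ f)).1 (w.1, w.2.1, w.2.2.1)
      + w.2.2.2.2 * extendZero (A.D₂ f).1 (w.1, w.2.1, w.2.2.1) := by
  obtain ⟨L, hL, hLv⟩ := hasFDerivAt_affine hU hd ((Hol.frame hU hd).D₁ (Hol.mk F hF))
    ((Hol.frame hU hd).D₂ (Hol.mk F hF)) (w := (w.1, w.2.1, w.2.2.1, w.2.2.2.1)) hw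
  have he : totalD1 F =ᶠ[𝓝 (w.1, w.2.1, w.2.2.1, w.2.2.2.1)] _ :=
    eventually_of_mem ((isOpen_preimage_proj₂ hU).mem_nhds hw) fun v hv => totalD1_eq hU hd hF hv
  rw [totalD2, he.fderiv_eq, hL.fderiv, hLv]
  simp only [extendZero_apply _ hw]
  change _ = _ + _ * (((Hol.frame hU hd).D₂ ((Hol.frame hU hd).D₁ (Hol.mk F hF))).1 ⟨_, hw⟩ +
    ((Hol.frame hU hd).D₁ ((Hol.frame hU hd).D₂ (Hol.mk F hF))).1 ⟨_, hw⟩) + _ + _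
  ring

/-- The total derivative of a function `a + q b + q ^ 2 c + r d` of third jets, where the
coefficients are functions of first jets. -/
theorem hasFDerivAt_quadratic (hU : IsOpen U) (hd : U ⊆ dom) (a b c d : Hol U) {w : J3}
    (hw : (w.1, w.2.1, w.2.2.1) ∈ U) :
    ∃ L : J3 →L[ℂ] ℂ, HasFDerivAt (fun w : J3 => extendZero a.1 (w.1, w.2.1, w.2.2.1)
        + w.2.2.2.1 * extendZero b.1 (w.1, w.2.1, w.2.2.1)
        + w.2.2.2.1 ^ 2 * extendZero c.1 (w.1, w.2.1, w.2.2.1)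
        + w.2.2.2.2 * extendZero d.1 (w.1, w.2.1, w.2.2.1)) L w ∧
      ∀ s, L (1, w.2.2.1, w.2.2.2.1, w.2.2.2.2, s) =
        ((Hol.frame hU hd).D₁ a).1 ⟨_, hw⟩ + w.2.2.2.1 * ((Hol.frame hU hd).D₂ a).1 ⟨_, hw⟩
        + w.2.2.2.1 * (((Hol.frame hU hd).D₁ b).1 ⟨_, hw⟩
          + w.2.2.2.1 * ((Hol.frame hU hd).D₂ b).1 ⟨_, hw⟩)
        + w.2.2.2.1 ^ 2 * (((Hol.frame hU hd).D₁ c).1 ⟨_, hw⟩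
          + w.2.2.2.1 * ((Hol.frame hU hd).D₂ c).1 ⟨_, hw⟩)
        + w.2.2.2.2 * (((Hol.frame hU hd).D₁ d).1 ⟨_, hw⟩
          + w.2.2.2.1 * ((Hol.frame hU hd).D₂ d).1 ⟨_, hw⟩)
        + w.2.2.2.2 * b.1 ⟨_, hw⟩ + 2 * w.2.2.2.1 * w.2.2.2.2 * c.1 ⟨_, hw⟩
        + s * d.1 ⟨_, hw⟩ := by
  have hq : HasFDerivAt (fun w : J3 => w.2.2.2.1) coordQ₃ w := coordQ₃.hasFDerivAt
  have hr : HasFDerivAt (fun w : J3 => w.2.2.2.2) coordR₃ w := coordR₃.hasFDerivAt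
  refine ⟨_, (((hasFDerivAt_lift hU a proj₃ hw).add (hq.mul (hasFDerivAt_lift hU b proj₃ hw))).add
    ((hq.pow 2).mul (hasFDerivAt_lift hU c proj₃ hw))).add
    (hr.mul (hasFDerivAt_lift hU d proj₃ hw)), ?_⟩
  intro s
  have ea := Hol.fderiv_contact hU hd a hw w.2.2.2.1
  have eb := Hol.fderiv_contact hU hd b hw w.2.2.2.1
  have ec := Hol.fderiv_contact hU hd c hw w.2.2.2.1
  have ed := Hol.fderiv_contact hU hd d hw w.2.2.2.1
  have hb := extendZero_apply b.1 hw
  have hc := extendZero_apply c.1 hw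
  have hd' := extendZero_apply d.1 hw
  change fderiv ℂ (extendZero a.1) (w.1, w.2.1, w.2.2.1) (1, w.2.2.1, w.2.2.2.1)
    + (w.2.2.2.1 * fderiv ℂ (extendZero b.1) (w.1, w.2.1, w.2.2.1) (1, w.2.2.1, w.2.2.2.1)
      + extendZero b.1 (w.1, w.2.1, w.2.2.1) * w.2.2.2.2)
    + (w.2.2.2.1 ^ 2 * fderiv ℂ (extendZero c.1) (w.1, w.2.1, w.2.2.1) (1, w.2.2.1, w.2.2.2.1)
      + extendZero c.1 (w.1, w.2.1, w.2.2.1) * ((2 • w.2.2.2.1 ^ (2 - 1)) * w.2.2.2.2))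
    + (w.2.2.2.2 * fderiv ℂ (extendZero d.1) (w.1, w.2.1, w.2.2.1) (1, w.2.2.1, w.2.2.2.1)
      + extendZero d.1 (w.1, w.2.1, w.2.2.1) * s) = _
  rw [ea, eb, ec, ed, hb, hc, hd']
  simp only [Nat.add_one_sub_one, pow_one, nsmul_eq_mul]
  push_cast
  ring

/-- The linearized symmetry condition, split into the coefficients of the powers of `y''`. -/
theorem isLinearSymmetry_of_mem_complexGenerators {Q : J1 → ℂ} (hQ : Q ∈ complexGenerators) :
    (Hol.frame isOpen_dom subset_rfl).IsLinearSymmetry (Hol.mk Q hQ.1) := by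
  have hU := isOpen_dom
  have hd : dom ⊆ dom := subset_rfl
  obtain ⟨hQd, hQs⟩ := hQ
  obtain ⟨A, hA⟩ : ∃ A, A = Hol.frame isOpen_dom hd := ⟨_, rfl⟩
  obtain ⟨f, hf⟩ : ∃ f, f = Hol.mk Q hQd := ⟨_, rfl⟩
  change (Hol.frame isOpen_dom hd).IsLinearSymmetry (Hol.mk Q hQd)
  rw [← hA, ← hf]
  have key : ∀ z (hz : z ∈ dom), ∀ q : ℂ,
      let P := Hol.eval ⟨z, hz⟩
      (P (A.D₁ (A.D₁ (A.D₁ f))) + 1 / z.2.2 * P (A.D₁ (A.D₁ f)))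
      + q * (P (A.D₁ (A.D₁ (A.D₂ f))) + P (A.D₁ (A.D₂ (A.D₁ f))) + P (A.D₂ (A.D₁ (A.D₁ f)))
          - (1 / z.2.2 * P (A.D₁ (A.D₂ f)) + 1 / z.2.2 ^ 2 * P (A.D₁ f)
            + 2 / z.1 * P (A.D₁ (A.D₁ f))))
      + q ^ 2 * (P (A.D₂ (A.D₂ (A.D₁ f))) + P (A.D₂ (A.D₁ (A.D₂ f))) + P (A.D₁ (A.D₂ (A.D₂ f)))
          - (1 / z.1 * P (A.D₂ (A.D₁ f)) + 1 / z.1 ^ 2 * P (A.D₂ f)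
            + 2 / z.2.2 * P (A.D₂ (A.D₂ f))))
      + q ^ 3 * (P (A.D₂ (A.D₂ (A.D₂ f))) + 1 / z.1 * P (A.D₂ (A.D₂ f))) = 0 := by
    intro z hz q P
    have h := hQs z hz q 0
    have hx : z.1 ≠ 0 := hz.1
    have hp : z.2.2 ≠ 0 := hz.2
    obtain ⟨L, hL, hLv⟩ := hasFDerivAt_quadratic hU hd (A.D₁ (A.D₁ f))
      (A.D₂ (A.D₁ f) + A.D₁ (A.D₂ f)) (A.D₂ (A.D₂ f)) (A.D₂ f)
      (w := (z.1, z.2.1, z.2.2, q, omega (z.1, z.2.1, z.2.2, q))) hz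
    have he : totalD2 (totalD1 Q) =ᶠ[𝓝 (z.1, z.2.1, z.2.2, q, omega (z.1, z.2.1, z.2.2, q))] _ :=
      eventually_of_mem ((isOpen_preimage_proj₃ hU).mem_nhds hz) fun v hv =>
        totalD2_totalD1 hU hd hQd hv
    rw [← hA, ← hf] at he
    rw [← hA] at hLv
    have e2 : partialP Q z = P (A.D₂ f) := by
      rw [hA, hf]
      exact partialP_eq hU hd hQd hz
    have e1 : partialX Q z + z.2.2 * partialY Q z = P (A.D₁ f) := by
      rw [hA, hf]
      exact partialX_add_eq hU hd hQd hz
    rw [eta3, totalD3, he.fderiv_eq, hL.fderiv, hLv, fderiv_omega_apply hx hp, eta2,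
      totalD2_totalD1 hU hd hQd hz, xi, eta, eta1, e1] at h
    simp only [extendZero_apply _ hz] at h
    rw [← hA, ← hf] at h
    simp only [map_add] at h
    have hP : ∀ g : Hol dom, g.1 ⟨z, hz⟩ = P g := fun _ => rfl
    rw [e2] at h
    simp only [hP, map_add, omega] at h
    linear_combination (norm := skip) h
    field_simp
    ring
  have hx' : ∀ z : dom, Hol.eval z A.x' = 1 / z.1.1 := fun z => by
    rw [hA, one_div]
    exact Hol.frame_x'_apply isOpen_dom hd z
  have hp' : ∀ z : dom, Hol.eval z A.p' = 1 / z.1.2.2 := fun z => by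
    rw [hA, one_div]
    exact Hol.frame_p'_apply isOpen_dom hd z
  refine ⟨?_, ?_, ?_, ?_⟩
  all_goals
    refine Hol.ext_eval fun z => ?_
    obtain ⟨h0, h1, h2, h3⟩ := cubic_eq_zero (key z z.2)
    simp only [map_add, map_mul, map_neg, map_pow, map_ofNat, hx', hp']
  · linear_combination h0
  · linear_combination h1
  · linear_combination h2
  · linear_combination h3

/-! ### Local contact symmetries -/

variable {F : J1 → J1}

theorem IsContactSymmetryOn.differentiableOn_xHat (h : IsContactSymmetryOn U F) :
    DifferentiableOn ℂ (xHat F) U := h.holo.fst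

theorem IsContactSymmetryOn.differentiableOn_yHat (h : IsContactSymmetryOn U F) :
    DifferentiableOn ℂ (yHat F) U := h.holo.snd.fst

theorem IsContactSymmetryOn.differentiableOn_pHat (h : IsContactSymmetryOn U F) :
    DifferentiableOn ℂ (pHat F) U := h.holo.snd.snd

/-- The Jacobian determinant of the contact planes does not vanish: otherwise `dŷ = p̂ dx̂` at
the point, and the derivative is not surjective. -/
theorem IsContactSymmetryOn.jacobian_ne_zero (h : IsContactSymmetryOn U F) (hU : IsOpen U)
    (hd : U ⊆ dom) {X Y P : Hol U} (hX : X = Hol.mk _ h.differentiableOn_xHat)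
    (hY : Y = Hol.mk _ h.differentiableOn_yHat)
    (h₁ : (Hol.frame hU hd).D₁ Y = P * (Hol.frame hU hd).D₁ X)
    (h₂ : (Hol.frame hU hd).D₂ Y = P * (Hol.frame hU hd).D₂ X) (z : U) :
    ((Hol.frame hU hd).D₁ X * (Hol.frame hU hd).D₂ P
      - (Hol.frame hU hd).D₂ X * (Hol.frame hU hd).D₁ P).1 z ≠ 0 := by
  intro hJ
  have h₃ := ContactFrame.D₃_eq_of_contact h₁ h₂
  have e₁ := congrArg (Hol.eval z) h₁
  have e₂ := congrArg (Hol.eval z) h₂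
  have e₃ := congrArg (Hol.eval z) h₃
  change Hol.eval z ((Hol.frame hU hd).D₁ X * (Hol.frame hU hd).D₂ P
      - (Hol.frame hU hd).D₂ X * (Hol.frame hU hd).D₁ P) = 0 at hJ
  rw [map_add, hJ, add_zero] at e₃
  rw [map_mul] at e₁ e₂ e₃
  have d := (h.holo.differentiableAt (hU.mem_nhds z.2)).hasFDerivAt
  have dx : fderiv ℂ (extendZero X.1) z =
      (ContinuousLinearMap.fst ℂ ℂ (ℂ × ℂ)).comp (fderiv ℂ F z) := by
    rw [fderiv_extendZero_congr hU (f := X.1) (F := xHat F) (by subst hX; exact fun _ => rfl) z.2]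
    exact d.fst.fderiv
  have dy : fderiv ℂ (extendZero Y.1) z = ((ContinuousLinearMap.fst ℂ ℂ ℂ).comp
      (ContinuousLinearMap.snd ℂ ℂ (ℂ × ℂ))).comp (fderiv ℂ F z) := by
    rw [fderiv_extendZero_congr hU (f := Y.1) (F := yHat F) (by subst hY; exact fun _ => rfl) z.2]
    exact d.snd.fst.fderiv
  obtain ⟨v, hv⟩ := (h.localDiffeo z z.2).2 (0, 1, 0)
  have kx : fderiv ℂ (extendZero X.1) z v = 0 := by
    rw [dx, ContinuousLinearMap.comp_apply, hv]; rfl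
  have ky : fderiv ℂ (extendZero Y.1) z v = 1 := by
    rw [dy, ContinuousLinearMap.comp_apply, hv]; rfl
  rw [clm_J1_apply] at kx ky
  have a₁ : ∀ f, Hol.eval z ((Hol.frame hU hd).D₁ f) = fderiv ℂ (extendZero f.1) z (1, 0, 0)
    + z.1.2.2 * fderiv ℂ (extendZero f.1) z (0, 1, 0) := fun f => rfl
  have a₂ : ∀ f, Hol.eval z ((Hol.frame hU hd).D₂ f) = fderiv ℂ (extendZero f.1) z (0, 0, 1) :=
    fun f => rfl
  have a₃ : ∀ f, Hol.eval z ((Hol.frame hU hd).D₃ f) = fderiv ℂ (extendZero f.1) z (0, 1, 0) :=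
    fun f => rfl
  rw [a₁, a₁] at e₁
  rw [a₂, a₂] at e₂
  rw [a₃, a₃] at e₃
  refine one_ne_zero (α := ℂ) ?_
  linear_combination -ky + Hol.eval z P * kx + v.1 * e₁ + (v.2.1 - v.1 * z.1.2.2) * e₃ + v.2.2 * e₂

/-- The symmetry condition for `ŷ'' = N / M`, with the denominators `M` cleared. -/
theorem quotient_rule_mul_cube {M N M' N' X P : ℂ} (hM : M ≠ 0)
    (h : (N * (M' * -(M ^ 2)⁻¹) + M⁻¹ * N') / M = (N / M) ^ 2 / X - N / M / P) :
    N' * M - N * M' = N ^ 2 * M / X - N * M ^ 2 / P := by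
  have e : N' * M - N * M' = M ^ 3 * ((N * (M' * -(M ^ 2)⁻¹) + M⁻¹ * N') / M) := by
    field_simp
    ring
  rw [e, h, div_eq_mul_inv _ X, div_eq_mul_inv _ P, div_eq_mul_inv _ X, div_eq_mul_inv _ P]
  field_simp

/-- The contact condition and the symmetry condition, the latter split into the coefficients of the
powers of `y''`. -/
theorem IsContactSymmetryOn.isSymmetryMap (h : IsContactSymmetryOn U F) (hU : IsOpen U)
    (hd : U ⊆ dom) : ∃ X' P' J', (Hol.frame hU hd).IsSymmetryMap
      (Hol.mk _ h.differentiableOn_xHat) (Hol.mk _ h.differentiableOn_yHat)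
      (Hol.mk _ h.differentiableOn_pHat) X' P' J' := by
  obtain ⟨X, hX⟩ : ∃ X, X = Hol.mk _ h.differentiableOn_xHat := ⟨_, rfl⟩
  obtain ⟨Y, hY⟩ : ∃ Y, Y = Hol.mk _ h.differentiableOn_yHat := ⟨_, rfl⟩
  obtain ⟨P, hP⟩ : ∃ P, P = Hol.mk _ h.differentiableOn_pHat := ⟨_, rfl⟩
  rw [← hX, ← hY, ← hP]
  have h₁ : (Hol.frame hU hd).D₁ Y = P * (Hol.frame hU hd).D₁ X := by
    refine Hol.ext_eval fun z => ?_
    have := (h.contact z z.2).1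
    rw [partialX_add_eq hU hd h.differentiableOn_xHat z.2,
      partialX_add_eq hU hd h.differentiableOn_yHat z.2, ← hX, ← hY, mul_comm] at this
    rw [hP]
    exact this
  have h₂ : (Hol.frame hU hd).D₂ Y = P * (Hol.frame hU hd).D₂ X := by
    refine Hol.ext_eval fun z => ?_
    have := (h.contact z z.2).2
    rw [partialP_eq hU hd h.differentiableOn_xHat z.2,
      partialP_eq hU hd h.differentiableOn_yHat z.2, ← hX, ← hY, mul_comm] at this
    rw [hP]
    exact this
  have hJ := h.jacobian_ne_zero hU hd hX hY h₁ h₂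
  have hX0 : ∀ z, X.1 z ≠ 0 := fun z => by rw [hX]; exact (h.mapsTo z.2).1
  have hP0 : ∀ z, P.1 z ≠ 0 := fun z => by rw [hP]; exact (h.mapsTo z.2).2
  obtain ⟨A, hA⟩ : ∃ A, A = Hol.frame hU hd := ⟨_, rfl⟩
  -- the symmetry condition at `z` is a cubic equation in `q = y''`
  have key : ∀ z (hz : z ∈ U), ∀ q : ℂ,
      let E := Hol.eval ⟨z, hz⟩
      E (A.D₁ X) + q * E (A.D₂ X) ≠ 0 →
      (E (A.D₁ (A.D₁ P)) * E (A.D₁ X) - E (A.D₁ P) * E (A.D₁ (A.D₁ X))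
        - E (A.D₁ X) * E (A.D₁ P) * (E (A.D₁ P) / E X - E (A.D₁ X) / E P))
      + q * (E (A.D₁ (A.D₁ P)) * E (A.D₂ X)
        + (E (A.D₁ (A.D₂ P)) + E (A.D₂ (A.D₁ P))) * E (A.D₁ X)
        - E (A.D₁ P) * (E (A.D₁ (A.D₂ X)) + E (A.D₂ (A.D₁ X))) - E (A.D₂ P) * E (A.D₁ (A.D₁ X))
        - 1 / z.2.2 * (E (A.D₁ X) * E (A.D₂ P) - E (A.D₂ X) * E (A.D₁ P))
        - ((E (A.D₂ X) * E (A.D₁ P) ^ 2 + 2 * E (A.D₁ X) * E (A.D₁ P) * E (A.D₂ P)) / E X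
          - (E (A.D₂ P) * E (A.D₁ X) ^ 2 + 2 * E (A.D₁ P) * E (A.D₁ X) * E (A.D₂ X)) / E P))
      + q ^ 2 * (E (A.D₂ (A.D₂ P)) * E (A.D₁ X)
        + (E (A.D₁ (A.D₂ P)) + E (A.D₂ (A.D₁ P))) * E (A.D₂ X)
        - E (A.D₂ P) * (E (A.D₁ (A.D₂ X)) + E (A.D₂ (A.D₁ X))) - E (A.D₁ P) * E (A.D₂ (A.D₂ X))
        + 1 / z.1 * (E (A.D₁ X) * E (A.D₂ P) - E (A.D₂ X) * E (A.D₁ P))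
        - ((E (A.D₁ X) * E (A.D₂ P) ^ 2 + 2 * E (A.D₂ X) * E (A.D₁ P) * E (A.D₂ P)) / E X
          - (E (A.D₁ P) * E (A.D₂ X) ^ 2 + 2 * E (A.D₂ P) * E (A.D₁ X) * E (A.D₂ X)) / E P))
      + q ^ 3 * (E (A.D₂ (A.D₂ P)) * E (A.D₂ X) - E (A.D₂ P) * E (A.D₂ (A.D₂ X))
        - E (A.D₂ X) * E (A.D₂ P) * (E (A.D₂ P) / E X - E (A.D₂ X) / E P)) = 0 := by
    intro z hz q E hM
    have hx : z.1 ≠ 0 := (hd hz).1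
    have hp : z.2.2 ≠ 0 := (hd hz).2
    have hEX : E X ≠ 0 := hX0 _
    have hEP : E P ≠ 0 := hP0 _
    have hDX : totalD1 (xHat F) (z.1, z.2.1, z.2.2, q) = E (A.D₁ X) + q * E (A.D₂ X) := by
      rw [totalD1_eq hU hd h.differentiableOn_xHat hz, ← hX, ← hA, extendZero_apply _ hz,
        extendZero_apply _ hz]
      rfl
    have hDP : totalD1 (pHat F) (z.1, z.2.1, z.2.2, q) = E (A.D₁ P) + q * E (A.D₂ P) := by
      rw [totalD1_eq hU hd h.differentiableOn_pHat hz, ← hP, ← hA, extendZero_apply _ hz,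
        extendZero_apply _ hz]
      rfl
    have hs := h.symm z hz q (hDX ▸ hM)
    obtain ⟨L, hL, hLv⟩ := hasFDerivAt_affine hU hd (A.D₁ X) (A.D₂ X)
      (w := (z.1, z.2.1, z.2.2, q)) hz
    obtain ⟨K, hK, hKv⟩ := hasFDerivAt_affine hU hd (A.D₁ P) (A.D₂ P)
      (w := (z.1, z.2.1, z.2.2, q)) hz
    have he : qHat F =ᶠ[𝓝 (z.1, z.2.1, z.2.2, q)] fun w : J2 =>
        (extendZero (A.D₁ P).1 (w.1, w.2.1, w.2.2.1)
          + w.2.2.2 * extendZero (A.D₂ P).1 (w.1, w.2.1, w.2.2.1)) *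
        (extendZero (A.D₁ X).1 (w.1, w.2.1, w.2.2.1)
          + w.2.2.2 * extendZero (A.D₂ X).1 (w.1, w.2.1, w.2.2.1))⁻¹ :=
      eventually_of_mem ((isOpen_preimage_proj₂ hU).mem_nhds hz) fun v hv => by
        rw [qHat, totalD1_eq hU hd h.differentiableOn_xHat hv,
          totalD1_eq hU hd h.differentiableOn_pHat hv, ← hX, ← hP, ← hA, div_eq_mul_inv]
    have hM' : extendZero (A.D₁ X).1 z + q * extendZero (A.D₂ X).1 z ≠ 0 := by
      rw [extendZero_apply _ hz, extendZero_apply _ hz]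
      exact hM
    have hQ := hK.mul ((hasFDerivAt_inv hM').comp (z.1, z.2.1, z.2.2, q) hL)
    have hQ' := (hQ.congr_of_eventuallyEq he).fderiv
    rw [rHat, totalD2, hQ', qHat, hDX, hDP] at hs
    rw [← hA] at hLv hKv
    simp only [add_apply, smul_apply, Function.comp,
      ContinuousLinearMap.comp_apply, hLv, hKv, extendZero_apply _ hz, omega] at hs
    have hE : ∀ g : Hol U, g.1 ⟨z, hz⟩ = E g := fun _ => rfl
    have hxE : xHat F z = E X := by rw [hX]; rfl
    have hpE : pHat F z = E P := by rw [hP]; rfl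
    simp only [hE, hxE, hpE, ContinuousLinearMap.toSpanSingleton_apply, smul_eq_mul] at hs
    replace hs := quotient_rule_mul_cube hM hs
    linear_combination (norm := skip) hs
    field_simp
    ring
  have hx' : ∀ z : U, Hol.eval z A.x' = 1 / z.1.1 := fun z => by
    rw [hA, one_div]
    exact Hol.frame_x'_apply hU hd z
  have hp' : ∀ z : U, Hol.eval z A.p' = 1 / z.1.2.2 := fun z => by
    rw [hA, one_div]
    exact Hol.frame_p'_apply hU hd z
  have hXi : ∀ z : U, Hol.eval z (Hol.inv X hX0) = 1 / Hol.eval z X := fun z => by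
    rw [one_div]
    exact Hol.inv_apply X hX0 z
  have hPi : ∀ z : U, Hol.eval z (Hol.inv P hP0) = 1 / Hol.eval z P := fun z => by
    rw [one_div]
    exact Hol.inv_apply P hP0 z
  have hne : ∀ z : U, Hol.eval z (A.D₁ X) ≠ 0 ∨ Hol.eval z (A.D₂ X) ≠ 0 := by
    intro z
    by_contra! hcon
    refine hJ z ?_
    rw [← hA]
    change Hol.eval z (A.D₁ X * A.D₂ P - A.D₂ X * A.D₁ P) = 0
    rw [map_sub, map_mul, map_mul, hcon.1, hcon.2, zero_mul, zero_mul, sub_zero]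
  refine ⟨Hol.inv X hX0, Hol.inv P hP0, Hol.inv _ hJ, Hol.mul_inv _ _, Hol.mul_inv _ _,
    Hol.mul_inv _ _, h₁, h₂, ?_, ?_, ?_, ?_⟩
  all_goals
    rw [← hA]
    refine Hol.ext_eval fun z => ?_
    obtain ⟨h0, h1, h2, h3⟩ := cubic_eq_zero_of_ne (hne z) (key z z.2)
    simp only [map_add, map_sub, map_mul, map_pow, map_ofNat, hx', hp', hXi, hPi]
  · linear_combination h0
  · linear_combination h1
  · linear_combination h2
  · linear_combination h3

/-- The contact symmetries on a connected open set. -/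
theorem IsContactSymmetryOn.exists_eqOn (h : IsContactSymmetryOn U F) (hU : IsOpen U)
    (hc : IsConnected U) (hd : U ⊆ dom) : ∃ a b : ℂ, a ≠ 0 ∧
      ((∀ z ∈ U, F z = (a * z.1, a ^ 2 * z.2.1 + b, a * z.2.2)) ∨
        ∀ z ∈ U, F z = (a * z.2.2, a ^ 2 * (z.1 * z.2.2 - z.2.1) + b, a * z.1)) := by
  obtain ⟨X', P', J', hS⟩ := h.isSymmetryMap hU hd
  have := Hol.nontrivial hc.nonempty
  obtain ⟨a, b, ha, hab⟩ := hS.exists_eq (Hol.exists_eq_algebraMap hU hd hc.isPreconnected)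
  refine ⟨a, b, ha, hab.imp ?_ ?_⟩
  all_goals
    rintro ⟨h1, h2, h3⟩ z hz
    exact Prod.ext (congrArg (Hol.eval ⟨z, hz⟩) h1)
      (Prod.ext (congrArg (Hol.eval ⟨z, hz⟩) h2) (congrArg (Hol.eval ⟨z, hz⟩) h3))

/-! ### The group of global contact symmetries -/

/-- The transformation `(x, y, p) ↦ (a x, a ^ 2 y + b, a p)`. -/
def scaling (a : ℂˣ) (b : ℂ) : Equiv.Perm dom where
  toFun z := ⟨(a * z.1.1, a ^ 2 * z.1.2.1 + b, a * z.1.2.2),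
    mul_ne_zero a.ne_zero z.2.1, mul_ne_zero a.ne_zero z.2.2⟩
  invFun z := ⟨(↑a⁻¹ * z.1.1, (↑a⁻¹ : ℂ) ^ 2 * (z.1.2.1 - b), ↑a⁻¹ * z.1.2.2),
    mul_ne_zero a⁻¹.ne_zero z.2.1, mul_ne_zero a⁻¹.ne_zero z.2.2⟩
  left_inv z := by
    ext <;> simp
  right_inv z := by
    ext <;> simp

theorem scaling_apply (a : ℂˣ) (b : ℂ) (z : dom) :
    (scaling a b z : J1) = (a * z.1.1, a ^ 2 * z.1.2.1 + b, a * z.1.2.2) := rfl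

theorem gamma2_apply (z : dom) :
    (gamma2 z : J1) = (z.1.2.2, z.1.1 * z.1.2.2 - z.1.2.1, z.1.1) := rfl

theorem scaling_mul_scaling (a a' : ℂˣ) (b b' : ℂ) :
    scaling a b * scaling a' b' = scaling (a * a') (a ^ 2 * b' + b) := by
  ext z <;> simp [scaling_apply] <;> ring

theorem scaling_one_zero : scaling 1 0 = 1 := by
  ext z <;> simp [scaling_apply]

theorem scaling_inv (a : ℂˣ) (b : ℂ) :
    (scaling a b)⁻¹ = scaling a⁻¹ (-((↑a⁻¹ : ℂ) ^ 2 * b)) := by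
  rw [inv_eq_iff_mul_eq_one, scaling_mul_scaling, mul_inv_cancel, ← scaling_one_zero]
  congr 1
  simp

theorem gamma2_mul_gamma2 : gamma2 * gamma2 = 1 := by
  ext z
  all_goals simp [gamma2_apply, mul_comm]

theorem gamma2_inv : gamma2⁻¹ = gamma2 := inv_eq_of_mul_eq_one_right gamma2_mul_gamma2

theorem gamma2_mul_scaling (a : ℂˣ) (b : ℂ) :
    gamma2 * scaling a b = scaling a (-b) * gamma2 := by
  ext z <;> simp [gamma2_apply, scaling_apply]
  ring

theorem gamma1_eq : gamma1 = scaling (Units.mk0 Complex.I Complex.I_ne_zero) 0 := by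
  ext z <;> simp [gamma1, scaling_apply]

theorem scaling_injective {a a' : ℂˣ} {b b' : ℂ} (h : scaling a b = scaling a' b') :
    a = a' ∧ b = b' := by
  have h' := congrArg Subtype.val (Equiv.congr_fun h ⟨(1, 0, 1), one_ne_zero, one_ne_zero⟩)
  simp only [scaling_apply, Prod.mk.injEq, mul_one, mul_zero, zero_add] at h'
  exact ⟨Units.ext h'.1, h'.2.1⟩

/-- The first component of a scaling depends on `x`, that of its product with the Legendre transform
only on `p`. -/
theorem scaling_ne_scaling_mul_gamma2 (a a' : ℂˣ) (b b' : ℂ) :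
    scaling a b ≠ scaling a' b' * gamma2 := by
  intro h
  have h1 := congrArg (fun z : dom => z.1.1)
    (Equiv.congr_fun h ⟨(1, 0, 1), one_ne_zero, one_ne_zero⟩)
  have h2 := congrArg (fun z : dom => z.1.1)
    (Equiv.congr_fun h ⟨(2, 0, 1), two_ne_zero, one_ne_zero⟩)
  simp [scaling_apply, gamma2_apply] at h1 h2
  rw [← h1] at h2
  exact a.ne_zero (by linear_combination h2)

theorem isConnected_dom : IsConnected dom := by
  have h0 : IsConnected ({0}ᶜ : Set ℂ) :=
    isConnected_compl_singleton_of_one_lt_rank (by simp) 0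
  have : dom = ({0}ᶜ : Set ℂ) ×ˢ ((univ : Set ℂ) ×ˢ ({0}ᶜ : Set ℂ)) := by
    ext z
    simp [dom]
  rw [this]
  exact h0.prod (isConnected_univ.prod h0)

theorem hasFDerivAt_fst₁ (z : J1) : HasFDerivAt (fun z : J1 => z.1)
    (ContinuousLinearMap.fst ℂ ℂ (ℂ × ℂ)) z := hasFDerivAt_fst

theorem hasFDerivAt_snd₁ (z : J1) : HasFDerivAt (fun z : J1 => z.2.1)
    ((ContinuousLinearMap.fst ℂ ℂ ℂ).comp (ContinuousLinearMap.snd ℂ ℂ (ℂ × ℂ))) z :=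
  ((ContinuousLinearMap.fst ℂ ℂ ℂ).comp (ContinuousLinearMap.snd ℂ ℂ (ℂ × ℂ))).hasFDerivAt

theorem hasFDerivAt_thd₁ (z : J1) : HasFDerivAt (fun z : J1 => z.2.2)
    ((ContinuousLinearMap.snd ℂ ℂ ℂ).comp (ContinuousLinearMap.snd ℂ ℂ (ℂ × ℂ))) z :=
  ((ContinuousLinearMap.snd ℂ ℂ ℂ).comp (ContinuousLinearMap.snd ℂ ℂ (ℂ × ℂ))).hasFDerivAt

/-- These maps preserve `y''`. -/
theorem isContactSymmetryOn_scaling {a : ℂ} (ha : a ≠ 0) (b : ℂ) :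
    IsContactSymmetryOn dom fun z => (a * z.1, a ^ 2 * z.2.1 + b, a * z.2.2) := by
  obtain ⟨F, hF⟩ : ∃ F : J1 → J1, F = fun z => (a * z.1, a ^ 2 * z.2.1 + b, a * z.2.2) := ⟨_, rfl⟩
  have hx : ∀ z v, fderiv ℂ (xHat F) z v = a * v.1 := fun z v => by
    subst hF; exact DFunLike.congr_fun ((hasFDerivAt_fst₁ z).const_mul a).fderiv v
  have hy : ∀ z v, fderiv ℂ (yHat F) z v = a ^ 2 * v.2.1 := fun z v => by
    subst hF
    exact DFunLike.congr_fun (((hasFDerivAt_snd₁ z).const_mul (a ^ 2)).add_const b).fderiv v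
  have hp : ∀ z v, fderiv ℂ (pHat F) z v = a * v.2.2 := fun z v => by
    subst hF; exact DFunLike.congr_fun ((hasFDerivAt_thd₁ z).const_mul a).fderiv v
  have hFd : ∀ z, ∃ L, HasFDerivAt F L z ∧ ∀ v, L v = (a * v.1, a ^ 2 * v.2.1, a * v.2.2) :=
      fun z => by
    subst hF
    exact ⟨_, ((hasFDerivAt_fst₁ z).const_mul a).prodMk
      ((((hasFDerivAt_snd₁ z).const_mul (a ^ 2)).add_const b).prodMk
        ((hasFDerivAt_thd₁ z).const_mul a)), fun v => rfl⟩
  have hq : qHat F = fun w : J2 => w.2.2.2 := by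
    funext w
    rw [qHat, totalD1, totalD1, hx, hp]
    field_simp
  rw [← hF]
  refine ⟨fun z _ => (hFd z).choose_spec.1.differentiableAt.differentiableWithinAt,
    fun z hz => by subst hF; exact ⟨mul_ne_zero ha hz.1, mul_ne_zero ha hz.2⟩, fun z _ => ?_,
    fun z _ => ?_, fun z hz q _ => ?_⟩
  · have e : ∀ v, fderiv ℂ F z v = (a * v.1, a ^ 2 * v.2.1, a * v.2.2) := fun v => by
      rw [(hFd z).choose_spec.1.fderiv, (hFd z).choose_spec.2]
    refine ⟨fun v w hvw => ?_, fun v => ⟨(v.1 / a, v.2.1 / a ^ 2, v.2.2 / a), ?_⟩⟩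
    · rw [e, e] at hvw
      simpa [ha, Prod.ext_iff] using hvw
    · rw [e]
      ext <;> simp <;> field_simp
  · simp only [ContactConditionAt, partialX, partialY, partialP, hx, hy]
    subst hF
    simp [pHat]
    ring
  · have hd : ∀ w v, fderiv ℂ (fun w : J2 => w.2.2.2) w v = v.2.2.2 := fun w v => by
      exact DFunLike.congr_fun (coordQ₂.hasFDerivAt (x := w)).fderiv v
    have hx0 := hz.1
    have hp0 := hz.2
    rw [rHat, totalD2, totalD1, hx, hq, hd]
    subst hF
    simp only [omega, xHat, pHat]
    field_simp

/-- These maps send `y''` to its inverse. -/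
theorem isContactSymmetryOn_scaling_legendre {a : ℂ} (ha : a ≠ 0) (b : ℂ) :
    IsContactSymmetryOn dom
      fun z => (a * z.2.2, a ^ 2 * (z.1 * z.2.2 - z.2.1) + b, a * z.1) := by
  obtain ⟨F, hF⟩ : ∃ F : J1 → J1,
    F = fun z => (a * z.2.2, a ^ 2 * (z.1 * z.2.2 - z.2.1) + b, a * z.1) := ⟨_, rfl⟩
  have hx : ∀ z v, fderiv ℂ (xHat F) z v = a * v.2.2 := fun z v => by
    subst hF; exact DFunLike.congr_fun ((hasFDerivAt_thd₁ z).const_mul a).fderiv v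
  have hy' : ∀ z, HasFDerivAt (fun z : J1 => a ^ 2 * (z.1 * z.2.2 - z.2.1) + b) _ z := fun z =>
    ((((hasFDerivAt_fst₁ z).mul (hasFDerivAt_thd₁ z)).sub (hasFDerivAt_snd₁ z)).const_mul
      (a ^ 2)).add_const b
  have hy : ∀ z v, fderiv ℂ (yHat F) z v = a ^ 2 * (z.1 * v.2.2 + z.2.2 * v.1 - v.2.1) :=
      fun z v => by
    subst hF
    exact DFunLike.congr_fun (hy' z).fderiv v
  have hp : ∀ z v, fderiv ℂ (pHat F) z v = a * v.1 := fun z v => by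
    subst hF; exact DFunLike.congr_fun ((hasFDerivAt_fst₁ z).const_mul a).fderiv v
  have hFd : ∀ z, ∃ L, HasFDerivAt F L z ∧ ∀ v,
      L v = (a * v.2.2, a ^ 2 * (z.1 * v.2.2 + z.2.2 * v.1 - v.2.1), a * v.1) := fun z => by
    subst hF
    exact ⟨_, ((hasFDerivAt_thd₁ z).const_mul a).prodMk
      ((hy' z).prodMk ((hasFDerivAt_fst₁ z).const_mul a)), fun v => rfl⟩
  have hq : qHat F = fun w : J2 => w.2.2.2⁻¹ := by
    funext w
    rw [qHat, totalD1, totalD1, hx, hp, mul_div_mul_left _ _ ha, one_div]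
  rw [← hF]
  refine ⟨fun z _ => (hFd z).choose_spec.1.differentiableAt.differentiableWithinAt,
    fun z hz => by subst hF; exact ⟨mul_ne_zero ha hz.2, mul_ne_zero ha hz.1⟩, fun z _ => ?_,
    fun z _ => ?_, fun z hz q hq0 => ?_⟩
  · have e : ∀ v, fderiv ℂ F z v =
        (a * v.2.2, a ^ 2 * (z.1 * v.2.2 + z.2.2 * v.1 - v.2.1), a * v.1) := fun v => by
      rw [(hFd z).choose_spec.1.fderiv, (hFd z).choose_spec.2]
    refine ⟨fun v w hvw => ?_, fun v => ⟨(v.2.2 / a,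
      z.1 * (v.1 / a) + z.2.2 * (v.2.2 / a) - v.2.1 / a ^ 2, v.1 / a), ?_⟩⟩
    · rw [e, e] at hvw
      simp only [Prod.mk.injEq, mul_eq_mul_left_iff, ha, or_false, ne_eq, OfNat.ofNat_ne_zero,
        not_false_eq_true, pow_eq_zero_iff] at hvw
      obtain ⟨h1, h2, h3⟩ := hvw
      rw [h1, h3] at h2
      exact Prod.ext h3 (Prod.ext (by linear_combination -h2) h1)
    · rw [e]
      ext <;> simp <;> field_simp
  · simp only [ContactConditionAt, partialX, partialY, partialP, hx, hy]
    subst hF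
    simp [pHat]
    exact ⟨by ring, by ring⟩
  · rw [totalD1, hx] at hq0
    have hq1 : q ≠ 0 := right_ne_zero_of_mul hq0
    have hx0 := hz.1
    have hp0 := hz.2
    have hd : ∀ v, fderiv ℂ (fun w : J2 => w.2.2.2⁻¹) (z.1, z.2.1, z.2.2, q) v =
        -(q ^ 2)⁻¹ * v.2.2.2 := fun v => by
      exact (DFunLike.congr_fun ((hasFDerivAt_inv hq1).comp (z.1, z.2.1, z.2.2, q)
        coordQ₂.hasFDerivAt).fderiv v).trans (mul_comm _ _)
    rw [rHat, totalD2, totalD1, hx, hq, hd]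
    subst hF
    simp only [omega, xHat, pHat]
    field_simp
    ring

theorem isContactSymmetry_iff {Γ : Equiv.Perm dom} : IsContactSymmetry Γ ↔
    ∃ a b, Γ = scaling a b ∨ Γ = scaling a b * gamma2 := by
  constructor
  · rintro ⟨F, hF, hΓ⟩
    obtain ⟨a, b, ha, hab⟩ := hF.exists_eqOn isOpen_dom isConnected_dom subset_rfl
    refine ⟨Units.mk0 a ha, b, hab.imp ?_ ?_⟩
    all_goals exact fun h => Equiv.ext fun z => Subtype.ext ((hΓ z).trans (h z z.2))
  · rintro ⟨a, b, rfl | rfl⟩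
    · exact ⟨_, isContactSymmetryOn_scaling a.ne_zero b, fun z => rfl⟩
    · exact ⟨_, isContactSymmetryOn_scaling_legendre a.ne_zero b, fun z => rfl⟩

/-- The group of global contact symmetries. -/
def symmetryGroup : Subgroup (Equiv.Perm dom) where
  carrier := {Γ | IsContactSymmetry Γ}
  one_mem' := isContactSymmetry_iff.2 ⟨1, 0, .inl scaling_one_zero.symm⟩
  mul_mem' {Γ Γ'} h h' := by
    obtain ⟨a, b, h⟩ := isContactSymmetry_iff.1 h
    obtain ⟨a', b', h'⟩ := isContactSymmetry_iff.1 h'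
    refine isContactSymmetry_iff.2 ?_
    rcases h with rfl | rfl <;> rcases h' with rfl | rfl
    · exact ⟨_, _, .inl (scaling_mul_scaling a a' b b')⟩
    · exact ⟨_, _, .inr (by rw [← mul_assoc, scaling_mul_scaling])⟩
    · exact ⟨_, _, .inr (by
        rw [mul_assoc, gamma2_mul_scaling, ← mul_assoc, scaling_mul_scaling])⟩
    · exact ⟨_, _, .inl (by
        rw [mul_assoc, ← mul_assoc gamma2, gamma2_mul_scaling, mul_assoc, gamma2_mul_gamma2,
          mul_one, scaling_mul_scaling])⟩
  inv_mem' {Γ} h := by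
    obtain ⟨a, b, h⟩ := isContactSymmetry_iff.1 h
    refine isContactSymmetry_iff.2 ?_
    rcases h with rfl | rfl
    · exact ⟨_, _, .inl (scaling_inv a b)⟩
    · exact ⟨_, _, .inr (by rw [mul_inv_rev, gamma2_inv, scaling_inv, gamma2_mul_scaling])⟩

/-! ### The generators -/

theorem exists_eq_of_mem_complexGenerators {Q : J1 → ℂ} (hQ : Q ∈ complexGenerators) :
    ∃ c d : ℂ, ∀ z ∈ dom, Q z = c + d * (2 * z.2.1 - z.1 * z.2.2) := by
  obtain ⟨c, d, h⟩ := (isLinearSymmetry_of_mem_complexGenerators hQ).exists_eq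
    (Hol.exists_eq_algebraMap isOpen_dom subset_rfl isConnected_dom.isPreconnected)
  exact ⟨c, d, fun z hz => congrArg (Hol.eval ⟨z, hz⟩) h⟩

theorem hasFDerivAt_generator (c d : ℂ) (z : J1) :
    ∃ L : J1 →L[ℂ] ℂ, HasFDerivAt (fun z : J1 => c + d * (2 * z.2.1 - z.1 * z.2.2)) L z ∧
      ∀ v, L v = d * (2 * v.2.1 - (z.1 * v.2.2 + z.2.2 * v.1)) :=
  ⟨_, ((((hasFDerivAt_snd₁ z).const_mul 2).sub
    ((hasFDerivAt_fst₁ z).mul (hasFDerivAt_thd₁ z))).const_mul d).const_add c, fun _ => rfl⟩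

theorem fderiv_generator (c d : ℂ) (z v : J1) :
    fderiv ℂ (fun z : J1 => c + d * (2 * z.2.1 - z.1 * z.2.2)) z v =
      d * (2 * v.2.1 - (z.1 * v.2.2 + z.2.2 * v.1)) := by
  obtain ⟨L, hL, h⟩ := hasFDerivAt_generator c d z
  rw [hL.fderiv, h]

theorem mem_complexGenerators (c d : ℂ) :
    (fun z : J1 => c + d * (2 * z.2.1 - z.1 * z.2.2)) ∈ complexGenerators := by
  obtain ⟨Q, hQ⟩ : ∃ Q : J1 → ℂ, Q = fun z => c + d * (2 * z.2.1 - z.1 * z.2.2) := ⟨_, rfl⟩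
  have hQ' : ∀ z v, fderiv ℂ Q z v = d * (2 * v.2.1 - (z.1 * v.2.2 + z.2.2 * v.1)) := fun z v => by
    rw [hQ, fderiv_generator]
  have h1 : totalD1 Q = fun w : J2 => d * (w.2.2.1 - w.1 * w.2.2.2) := by
    funext w
    rw [totalD1, hQ']
    ring
  have h2 : totalD2 (totalD1 Q) = fun w : J3 => -d * (w.1 * w.2.2.2.2) := by
    funext w
    have hp := ((ContinuousLinearMap.fst ℂ ℂ ℂ).comp ((ContinuousLinearMap.snd ℂ ℂ (ℂ × ℂ)).comp
      (ContinuousLinearMap.snd ℂ ℂ (ℂ × ℂ × ℂ)))).hasFDerivAt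
        (x := (w.1, w.2.1, w.2.2.1, w.2.2.2.1))
    have hx := (ContinuousLinearMap.fst ℂ ℂ (ℂ × ℂ × ℂ)).hasFDerivAt
      (x := (w.1, w.2.1, w.2.2.1, w.2.2.2.1))
    have h := DFunLike.congr_fun ((hp.sub (hx.mul coordQ₂.hasFDerivAt)).const_mul d).fderiv
      (1, w.2.2.1, w.2.2.2.1, w.2.2.2.2)
    rw [h1]
    refine h.trans ?_
    change d * (w.2.2.2.1 - (w.1 * w.2.2.2.2 + w.2.2.2.1 * 1)) = _
    ring
  rw [← hQ]
  refine ⟨?_, fun z hz q s => ?_⟩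
  · intro z _
    rw [hQ]
    exact (hasFDerivAt_generator c d z).choose_spec.1.differentiableAt.differentiableWithinAt
  · have h3 : ∀ w : J4, totalD3 (totalD2 (totalD1 Q)) w =
        -d * (w.1 * w.2.2.2.2.2 + w.2.2.2.2.1) := by
      intro w
      have hx := (ContinuousLinearMap.fst ℂ ℂ (ℂ × ℂ × ℂ × ℂ)).hasFDerivAt
        (x := (w.1, w.2.1, w.2.2.1, w.2.2.2.1, w.2.2.2.2.1))
      have h := DFunLike.congr_fun ((hx.mul coordR₃.hasFDerivAt).const_mul (-d)).fderiv
        (1, w.2.2.1, w.2.2.2.1, w.2.2.2.2.1, w.2.2.2.2.2)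
      rw [h2]
      refine h.trans ?_
      change -d * (w.1 * w.2.2.2.2.2 + w.2.2.2.2.1 * 1) = _
      ring
    have hx0 := hz.1
    have hp0 := hz.2
    rw [fderiv_omega_apply hz.1 hz.2, eta3, h3, eta2, h2, xi, eta, eta1]
    simp only [partialX, partialY, partialP, hQ', omega]
    field_simp
    ring

theorem field_eq {Q : J1 → ℂ} {c d : ℂ}
    (hQ : ∀ z ∈ dom, Q z = c + d * (2 * z.2.1 - z.1 * z.2.2)) {z : J1} (hz : z ∈ dom) :
    field Q z = (d * z.1, c + 2 * d * z.2.1, d * z.2.2) := by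
  have h : ∀ v, fderiv ℂ Q z v = d * (2 * v.2.1 - (z.1 * v.2.2 + z.2.2 * v.1)) := fun v => by
    rw [Filter.EventuallyEq.fderiv_eq (eventually_of_mem (isOpen_dom.mem_nhds hz) hQ),
      fderiv_generator]
  rw [field, xi, eta, eta1, hQ z hz]
  simp only [partialX, partialY, partialP, h]
  ext <;> simp <;> ring

theorem im_eq_zero_of_mem_realGenerators {Q : J1 → ℂ} {c d : ℂ} (hr : Q ∈ realGenerators)
    (hQ : ∀ z ∈ dom, Q z = c + d * (2 * z.2.1 - z.1 * z.2.2)) : c.im = 0 ∧ d.im = 0 := by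
  have hz : ∀ y : ℝ, (((1 : ℝ) : ℂ), (y : ℂ), ((1 : ℝ) : ℂ)) ∈ dom := fun y =>
    ⟨by simp, by simp⟩
  have h0 := hr.2 1 0 1 (hz 0)
  have h1 := hr.2 1 1 1 (hz 1)
  rw [hQ _ (hz _)] at h0 h1
  simp at h0 h1
  constructor <;> linarith

/-! ### The flows -/

theorem eq_exp_mul_of_hasDerivAt {f : ℝ → ℂ} {d : ℂ} (h : ∀ t, HasDerivAt f (d * f t) t) (t : ℝ) :
    f t = Complex.exp (d * t) * f 0 := by
  have he : ∀ s : ℝ, HasDerivAt (fun s : ℝ => Complex.exp (-d * s)) (Complex.exp (-d * s) * -d) s :=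
    fun s => by simpa using ((Complex.ofRealCLM.hasDerivAt (x := s)).const_mul (-d)).cexp
  have hg : ∀ s, HasDerivAt (fun s : ℝ => Complex.exp (-d * s) * f s) 0 s := fun s => by
    have := (he s).mul (h s)
    exact this.congr_deriv (by ring)
  have hc := is_const_of_deriv_eq_zero (fun s => (hg s).differentiableAt) (fun s => (hg s).deriv)
    t 0
  simp only [Complex.ofReal_zero, mul_zero, Complex.exp_zero, one_mul] at hc
  rw [← hc, ← mul_assoc, ← Complex.exp_add]
  simp

/-- A one-parameter group with characteristic function `c + d (2 y - x p)` scales by `exp (d ε)` and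
translates by the second component of the orbit of `(1, 0, 1)`. -/
theorem IsFlow.eq_scaling {Q : J1 → ℂ} {c d : ℂ} {φ : ℝ → Equiv.Perm dom} (h : IsFlow Q φ)
    (hQ : ∀ z ∈ dom, Q z = c + d * (2 * z.2.1 - z.1 * z.2.2)) (ε : ℝ) :
    ∃ b : ℂ, (c.im = 0 → d.im = 0 → b.im = 0) ∧
      φ ε = scaling (Units.mk0 (Complex.exp (d * ε)) (Complex.exp_ne_zero _)) b := by
  obtain ⟨h0, h1⟩ := h
  have h2 : ∀ (z : dom) (t : ℝ), HasDerivAt (fun t => (φ t z : J1))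
      (d * (φ t z).1.1, c + 2 * d * (φ t z).1.2.1, d * (φ t z).1.2.2) t := fun z t => by
    rw [← field_eq hQ (φ t z).2]
    exact h1 z t
  have hx : ∀ (z : dom) (t : ℝ), HasDerivAt (fun t => (φ t z).1.1) (d * (φ t z).1.1) t :=
    fun z t => (h2 z t).fst
  have hy : ∀ (z : dom) (t : ℝ), HasDerivAt (fun t => (φ t z).1.2.1)
      (c + 2 * d * (φ t z).1.2.1) t := fun z t => (h2 z t).snd.fst
  have hp : ∀ (z : dom) (t : ℝ), HasDerivAt (fun t => (φ t z).1.2.2) (d * (φ t z).1.2.2) t :=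
    fun z t => (h2 z t).snd.snd
  obtain ⟨z₀, hz₀⟩ : ∃ z₀ : dom, z₀.1.2.1 = 0 := ⟨⟨(1, 0, 1), one_ne_zero, one_ne_zero⟩, rfl⟩
  refine ⟨(φ ε z₀).1.2.1, fun hc hd => ?_, Equiv.ext fun z => Subtype.ext ?_⟩
  -- for real `c` and `d` the imaginary part obeys a homogeneous linear equation
  · have him : ∀ t, HasDerivAt (fun t => (((φ t z₀).1.2.1.im : ℝ) : ℂ))
        (2 * d * ((φ t z₀).1.2.1.im : ℝ)) t := fun t => by
      have := (Complex.ofRealCLM.comp Complex.imCLM).hasFDerivAt.comp_hasDerivAt t (hy z₀ t)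
      refine this.congr_deriv ?_
      apply Complex.ext <;> simp [hc, hd]
    have := eq_exp_mul_of_hasDerivAt him ε
    simpa [h0, hz₀] using this
  -- the difference of the second components of two orbits obeys a homogeneous linear equation
  · have hdiff : ∀ t, HasDerivAt (fun t => (φ t z).1.2.1 - (φ t z₀).1.2.1)
        (2 * d * ((φ t z).1.2.1 - (φ t z₀).1.2.1)) t := fun t => by
      have := (hy z t).sub (hy z₀ t)
      exact this.congr_deriv (by ring)
    have e1 := eq_exp_mul_of_hasDerivAt (hx z) ε
    have e2 := eq_exp_mul_of_hasDerivAt hdiff ε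
    have e3 := eq_exp_mul_of_hasDerivAt (hp z) ε
    simp only [h0, Equiv.Perm.one_apply, hz₀, sub_zero] at e1 e2 e3
    rw [scaling_apply]
    refine Prod.ext e1 (Prod.ext ?_ e3)
    rw [mul_assoc, two_mul, Complex.exp_add] at e2
    rw [Units.val_mk0]
    linear_combination e2

theorem isFlow_translation (c : ℂ) : IsFlow (fun z => c + 0 * (2 * z.2.1 - z.1 * z.2.2))
    (fun ε : ℝ => scaling 1 (ε * c)) := by
  refine ⟨by simp [scaling_one_zero], fun z ε => ?_⟩
  rw [field_eq (fun _ _ => rfl) (Subtype.prop _)]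
  have hb : HasDerivAt (fun t : ℝ => (t : ℂ) * c) (1 * c) ε :=
    (Complex.ofRealCLM.hasDerivAt (x := ε)).mul_const c
  have := (hasDerivAt_const ε z.1.1).prodMk
    ((hb.const_add z.1.2.1).prodMk (hasDerivAt_const ε z.1.2.2))
  simpa [scaling_apply] using this

theorem isFlow_scaling (d : ℂ) : IsFlow (fun z => 0 + d * (2 * z.2.1 - z.1 * z.2.2))
    (fun ε : ℝ => scaling (Units.mk0 (Complex.exp (ε * d)) (Complex.exp_ne_zero _)) 0) := by
  refine ⟨?_, fun z ε => ?_⟩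
  · simp only [Complex.ofReal_zero, zero_mul, Complex.exp_zero]
    rw [← scaling_one_zero]
    congr 1
    exact Units.ext rfl
  rw [field_eq (fun _ _ => rfl) (Subtype.prop _)]
  have he : HasDerivAt (fun t : ℝ => Complex.exp (t * d)) (Complex.exp (ε * d) * (1 * d)) ε :=
    ((Complex.ofRealCLM.hasDerivAt (x := ε)).mul_const d).cexp
  have := (he.mul_const z.1.1).prodMk
    (((he.pow 2).mul_const z.1.2.1).prodMk (he.mul_const z.1.2.2))
  refine (this.congr_deriv ?_).congr_of_eventuallyEq (.of_forall fun t => ?_)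
  · simp only [scaling_apply, Units.val_mk0]
    ext <;> simp <;> ring
  · simp [scaling_apply]

/-! ### The continuous symmetries -/

theorem scaling_mem_complexContinuousGroup (a : ℂˣ) (b : ℂ) :
    scaling a b ∈ complexContinuousGroup := by
  have h1 : scaling 1 b ∈ complexContinuousGroup := Subgroup.subset_closure
    ⟨_, mem_complexGenerators b 0, _, isFlow_translation b, 1, by simp⟩
  have h2 : scaling a 0 ∈ complexContinuousGroup := Subgroup.subset_closure
    ⟨_, mem_complexGenerators 0 (Complex.log a), _, isFlow_scaling _, 1, by
      congr 1
      ext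
      simp [Complex.exp_log a.ne_zero]⟩
  have := mul_mem h1 h2
  rwa [scaling_mul_scaling, one_mul, mul_zero, zero_add] at this

theorem mem_complexContinuousGroup {Γ : Equiv.Perm dom} :
    Γ ∈ complexContinuousGroup ↔ ∃ a b, Γ = scaling a b := by
  constructor
  · intro h
    induction h using Subgroup.closure_induction with
    | mem Γ h =>
      obtain ⟨Q, hQ, φ, hφ, ε, rfl⟩ := h
      obtain ⟨c, d, hcd⟩ := exists_eq_of_mem_complexGenerators hQ
      obtain ⟨b, -, hb⟩ := hφ.eq_scaling hcd ε
      exact ⟨_, b, hb⟩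
    | one => exact ⟨1, 0, scaling_one_zero.symm⟩
    | mul Γ Γ' _ _ h h' =>
      obtain ⟨a, b, rfl⟩ := h
      obtain ⟨a', b', rfl⟩ := h'
      exact ⟨_, _, scaling_mul_scaling a a' b b'⟩
    | inv Γ _ h =>
      obtain ⟨a, b, rfl⟩ := h
      exact ⟨_, _, scaling_inv a b⟩
  · rintro ⟨a, b, rfl⟩
    exact scaling_mem_complexContinuousGroup a b

theorem scaling_mem_continuousGroup {a : ℂˣ} {b : ℂ} (ha : 0 < (a : ℂ)) (hb : b.im = 0) :
    scaling a b ∈ continuousGroup := by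
  rw [Complex.pos_iff] at ha
  have h1 : scaling 1 b ∈ continuousGroup := Subgroup.subset_closure
    ⟨_, ⟨mem_complexGenerators b 0, fun x y p _ => by simp [hb]⟩, _, isFlow_translation b, 1,
      by simp⟩
  have h2 : scaling a 0 ∈ continuousGroup := Subgroup.subset_closure
    ⟨_, ⟨mem_complexGenerators 0 (Real.log (a : ℂ).re), fun x y p _ => by simp⟩, _,
      isFlow_scaling _, 1, by
      congr 1
      ext
      have : ((a : ℂ).re : ℂ) = a := Complex.ext rfl ha.2
      rw [Units.val_mk0, Complex.ofReal_one, one_mul, ← Complex.ofReal_exp, Real.exp_log ha.1,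
        this]⟩
  have := mul_mem h1 h2
  rwa [scaling_mul_scaling, one_mul, mul_zero, zero_add] at this

theorem mem_continuousGroup {Γ : Equiv.Perm dom} :
    Γ ∈ continuousGroup ↔ ∃ (a : ℂˣ) (b : ℂ), 0 < (a : ℂ) ∧ b.im = 0 ∧ Γ = scaling a b := by
  have hre : ∀ a : ℂˣ, 0 < (a : ℂ) → ∀ b : ℂ, b.im = 0 → ((a : ℂ) ^ 2 * b).im = 0 := by
    intro a ha b hb
    have := (Complex.pos_iff.1 ha).2
    simp [pow_two, ← this, hb]
  constructor
  · intro h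
    induction h using Subgroup.closure_induction with
    | mem Γ h =>
      obtain ⟨Q, hQ, φ, hφ, ε, rfl⟩ := h
      obtain ⟨c, d, hcd⟩ := exists_eq_of_mem_complexGenerators hQ.1
      obtain ⟨hc, hd⟩ := im_eq_zero_of_mem_realGenerators hQ hcd
      obtain ⟨b, hb, e⟩ := hφ.eq_scaling hcd ε
      refine ⟨_, b, ?_, hb hc hd, e⟩
      have hd' : d = (d.re : ℂ) := Complex.ext rfl hd
      rw [Units.val_mk0, hd', ← Complex.ofReal_mul, ← Complex.ofReal_exp]
      exact_mod_cast Real.exp_pos _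
    | one => exact ⟨1, 0, by simp, by simp, scaling_one_zero.symm⟩
    | mul Γ Γ' _ _ h h' =>
      obtain ⟨a, b, ha, hb, rfl⟩ := h
      obtain ⟨a', b', ha', hb', rfl⟩ := h'
      refine ⟨_, _, mul_pos ha ha', ?_, scaling_mul_scaling a a' b b'⟩
      rw [Complex.add_im, hre a ha b' hb', hb, add_zero]
    | inv Γ _ h =>
      obtain ⟨a, b, ha, hb, rfl⟩ := h
      have ha' : 0 < ((a⁻¹ : ℂˣ) : ℂ) := by simpa using ha
      refine ⟨_, _, ha', ?_, scaling_inv a b⟩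
      rw [Complex.neg_im, hre _ ha' b hb, neg_zero]
  · rintro ⟨a, b, ha, hb, rfl⟩
    exact scaling_mem_continuousGroup ha hb

theorem scaling_mem_continuousGroup_iff {a : ℂˣ} {b : ℂ} :
    scaling a b ∈ continuousGroup ↔ 0 < (a : ℂ) ∧ b.im = 0 := by
  refine ⟨fun h => ?_, fun h => scaling_mem_continuousGroup h.1 h.2⟩
  obtain ⟨a', b', ha, hb, e⟩ := mem_continuousGroup.1 h
  obtain ⟨rfl, rfl⟩ := scaling_injective e
  exact ⟨ha, hb⟩

/-! ### The normalizer of the continuous symmetries -/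

theorem scaling_conj (a a' : ℂˣ) (b b' : ℂ) : scaling a b * scaling a' b' * (scaling a b)⁻¹ =
    scaling a' (a ^ 2 * b' + b - a' ^ 2 * b) := by
  rw [mul_inv_eq_iff_eq_mul, scaling_mul_scaling, scaling_mul_scaling, mul_comm a]
  congr 1
  ring

theorem gamma2_conj (a : ℂˣ) (b : ℂ) : gamma2 * scaling a b * gamma2⁻¹ = scaling a (-b) := by
  rw [gamma2_mul_scaling, mul_inv_cancel_right]

theorem gamma2_mem_normalizer : gamma2 ∈ Subgroup.normalizer (continuousGroup : Set _) := by
  have h : ∀ c ∈ continuousGroup, gamma2 * c * gamma2⁻¹ ∈ continuousGroup := by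
    intro c hc
    obtain ⟨a, b, ha, hb, rfl⟩ := mem_continuousGroup.1 hc
    rw [gamma2_conj]
    exact scaling_mem_continuousGroup ha (by simp [hb])
  refine Subgroup.mem_normalizer_iff.2 fun c => ⟨h c, fun hc => ?_⟩
  have := h _ hc
  rwa [gamma2_inv, ← mul_assoc, ← mul_assoc, gamma2_mul_gamma2, one_mul, mul_assoc,
    gamma2_mul_gamma2, mul_one] at this

/-- Conjugation by a scaling multiplies real translations by `a ^ 2` and translates the centre of
real scalings by `b`. -/
theorem scaling_mem_normalizer_iff {a : ℂˣ} {b : ℂ} :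
    scaling a b ∈ Subgroup.normalizer (continuousGroup : Set _) ↔
      ((a : ℂ) ^ 2).im = 0 ∧ b.im = 0 := by
  constructor
  · intro h
    have h := Subgroup.mem_normalizer_iff.1 h
    constructor
    -- conjugate the translation by one
    · have := (h (scaling 1 1)).1 (scaling_mem_continuousGroup (by simp) (by simp))
      rw [scaling_conj, scaling_mem_continuousGroup_iff] at this
      simpa using this.2
    -- conjugate a proper scaling
    · have := (h (scaling (Units.mk0 2 two_ne_zero) 0)).1
        (scaling_mem_continuousGroup (by simp) (by simp))
      rw [scaling_conj, scaling_mem_continuousGroup_iff] at this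
      have h3 := this.2
      simp [pow_two] at h3
      linarith
  · rintro ⟨ha, hb⟩
    refine Subgroup.mem_normalizer_iff.2 fun c => ?_
    have key : ∀ a' : ℂˣ, ∀ b' : ℂ, scaling a' b' ∈ continuousGroup ↔
        scaling a' (a ^ 2 * b' + b - a' ^ 2 * b) ∈ continuousGroup := by
      intro a' b'
      rw [scaling_mem_continuousGroup_iff, scaling_mem_continuousGroup_iff]
      refine and_congr_right fun ha' => ?_
      have h1 : ((a' : ℂ) ^ 2 * b).im = 0 := by
        simp [pow_two, ← (Complex.pos_iff.1 ha').2, hb]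
      have h2 : ((a : ℂ) ^ 2).re ≠ 0 := fun h0 =>
        pow_ne_zero 2 a.ne_zero (Complex.ext h0 ha)
      rw [Complex.sub_im, Complex.add_im, h1, hb, add_zero, sub_zero, Complex.mul_im, ha, zero_mul,
        add_zero, mul_eq_zero, or_iff_right h2]
    constructor
    · intro hc
      obtain ⟨a', b', -, -, rfl⟩ := mem_continuousGroup.1 hc
      rw [scaling_conj]
      exact (key a' b').1 hc
    · intro hc
      obtain ⟨a', b', -, -, e⟩ := mem_continuousGroup.1 hc
      rw [mul_inv_eq_iff_eq_mul, ← eq_inv_mul_iff_mul_eq, scaling_inv, scaling_mul_scaling,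
        scaling_mul_scaling] at e
      rw [e, scaling_conj] at hc
      rw [e]
      exact (key _ _).2 hc

/-- The contact symmetries that normalize the group of continuous symmetries. -/
def normalizingGroup : Subgroup (Equiv.Perm dom) :=
  symmetryGroup ⊓ Subgroup.normalizer (continuousGroup : Set _)

theorem gamma1_mem_normalizingGroup : gamma1 ∈ normalizingGroup := by
  rw [gamma1_eq]
  exact ⟨isContactSymmetry_iff.2 ⟨_, _, .inl rfl⟩, scaling_mem_normalizer_iff.2 (by simp)⟩

theorem gamma2_mem_normalizingGroup : gamma2 ∈ normalizingGroup :=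
  ⟨isContactSymmetry_iff.2 ⟨1, 0, .inr (by rw [scaling_one_zero, one_mul])⟩,
    gamma2_mem_normalizer⟩

theorem complexContinuousGroup_le : complexContinuousGroup ≤ symmetryGroup := fun Γ h => by
  obtain ⟨a, b, rfl⟩ := mem_complexContinuousGroup.1 h
  exact isContactSymmetry_iff.2 ⟨a, b, .inl rfl⟩

theorem continuousGroup_le : continuousGroup ≤ complexContinuousGroup := fun Γ h => by
  obtain ⟨a, b, -, -, rfl⟩ := mem_continuousGroup.1 h
  exact scaling_mem_complexContinuousGroup a b

theorem gamma1_pow (n : ℕ) :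
    gamma1 ^ n = scaling (Units.mk0 Complex.I Complex.I_ne_zero ^ n) 0 := by
  induction n with
  | zero => rw [pow_zero, pow_zero, scaling_one_zero]
  | succ n ih => rw [pow_succ, ih, gamma1_eq, scaling_mul_scaling, ← pow_succ, mul_zero, add_zero]

theorem gamma1_pow_four : gamma1 ^ 4 = 1 := by
  rw [gamma1_pow, ← scaling_one_zero]
  congr 1
  ext
  simp

theorem commute_gamma : Commute gamma1 gamma2 := by
  change gamma1 * gamma2 = gamma2 * gamma1
  rw [gamma1_eq, gamma2_mul_scaling, neg_zero]

/-- The homomorphism `(m, k) ↦ Γ₁ ^ m Γ₂ ^ k`; the exponents are the least residues. -/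
noncomputable def gammaHom : Multiplicative (ZMod 4 × ZMod 2) →* Equiv.Perm dom :=
  MonoidHom.mk' (fun g => gamma1 ^ g.toAdd.1.val * gamma2 ^ g.toAdd.2.val) fun g g' => by
    rw [toAdd_mul, Prod.fst_add, Prod.snd_add, ZMod.val_add, ZMod.val_add,
      ← pow_eq_pow_mod _ gamma1_pow_four, ← pow_eq_pow_mod _ (by rw [pow_two, gamma2_mul_gamma2]),
      pow_add, pow_add, mul_assoc, mul_assoc, (commute_gamma.pow_pow _ _).left_comm]

theorem gammaHom_apply (m : ZMod 4) (k : ZMod 2) :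
    gammaHom (Multiplicative.ofAdd (m, k)) = gamma1 ^ m.val * gamma2 ^ k.val := rfl

theorem gammaHom_one_zero : gammaHom (Multiplicative.ofAdd (1, 0)) = gamma1 := by
  rw [gammaHom_apply]
  exact mul_one _

theorem gammaHom_zero_one : gammaHom (Multiplicative.ofAdd (0, 1)) = gamma2 := by
  rw [gammaHom_apply]
  exact one_mul _

theorem range_gammaHom : gammaHom.range = Subgroup.closure {gamma1, gamma2} := by
  refine le_antisymm ?_ ((Subgroup.closure_le _).2 ?_)
  · rintro _ ⟨g, rfl⟩
    exact mul_mem (pow_mem (Subgroup.subset_closure (by simp)) _)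
      (pow_mem (Subgroup.subset_closure (by simp)) _)
  · rintro _ (rfl | rfl)
    · exact ⟨_, gammaHom_one_zero⟩
    · exact ⟨_, gammaHom_zero_one⟩

theorem gammaHom_mem_normalizingGroup (g : Multiplicative (ZMod 4 × ZMod 2)) :
    gammaHom g ∈ normalizingGroup :=
  mul_mem (pow_mem gamma1_mem_normalizingGroup _) (pow_mem gamma2_mem_normalizingGroup _)

/-- Only the trivial product of the two transformations is a real continuous symmetry. This shows at
once that the homomorphism is injective, and injective modulo the continuous symmetries. -/
theorem eq_one_of_gammaHom_mem {g : Multiplicative (ZMod 4 × ZMod 2)}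
    (h : gammaHom g ∈ continuousGroup) : g = 1 := by
  obtain ⟨m, k⟩ := g
  change gamma1 ^ m.val * gamma2 ^ k.val ∈ continuousGroup at h
  rw [gamma1_pow] at h
  have hk : k = 0 ∨ k = 1 := by
    clear h
    revert k
    decide
  rcases hk with rfl | rfl
  · rw [ZMod.val_zero, pow_zero, mul_one, scaling_mem_continuousGroup_iff] at h
    have h1 := h.1
    rw [Units.val_pow_eq_pow_val, Units.val_mk0] at h1
    have hm : m = 0 := by
      by_contra hm
      have : m = 1 ∨ m = 2 ∨ m = 3 := by
        clear h h1
        revert m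
        decide
      rcases this with rfl | rfl | rfl
      · rw [show (1 : ZMod 4).val = 1 from rfl, pow_one, Complex.pos_iff] at h1
        simp at h1
      · rw [show (2 : ZMod 4).val = 2 from rfl, Complex.I_sq, Complex.pos_iff] at h1
        norm_num at h1
      · rw [show (3 : ZMod 4).val = 3 from rfl, Complex.I_pow_three, Complex.pos_iff] at h1
        simp at h1
    rw [hm]
    rfl
  · rw [show (1 : ZMod 2).val = 1 from rfl, pow_one] at h
    obtain ⟨a, b, -, -, e⟩ := mem_continuousGroup.1 h
    exact absurd e.symm (scaling_ne_scaling_mul_gamma2 _ _ _ _)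

theorem gammaHom_injective : Function.Injective gammaHom :=
  (injective_iff_map_eq_one gammaHom).2 fun _ hg => eq_one_of_gammaHom_mem (hg ▸ one_mem _)

/-- A complex number with real square lies on one of the four half-axes. -/
theorem exists_pos_mul_I_pow {a : ℂˣ} (h : ((a : ℂ) ^ 2).im = 0) :
    ∃ (m : ZMod 4) (r : ℂˣ), 0 < (r : ℂ) ∧
      a = Units.mk0 Complex.I Complex.I_ne_zero ^ m.val * r := by
  rw [pow_two, Complex.mul_im] at h
  have h' : (a : ℂ).re * (a : ℂ).im = 0 := by linarith
  have key : ∀ (m : ZMod 4), 0 < (a : ℂ) * (-Complex.I) ^ m.val →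
      ∃ (m : ZMod 4) (r : ℂˣ), 0 < (r : ℂ) ∧
        a = Units.mk0 Complex.I Complex.I_ne_zero ^ m.val * r := by
    intro m hm
    refine ⟨m, Units.mk0 _ hm.ne', hm, Units.ext ?_⟩
    simp only [Units.val_mul, Units.val_pow_eq_pow_val, Units.val_mk0]
    rw [mul_left_comm, ← mul_pow]
    simp
  have ha := a.ne_zero
  rcases mul_eq_zero.1 h' with h0 | h0
  · rcases lt_trichotomy (a : ℂ).im 0 with h1 | h1 | h1
    · refine key 3 ?_
      rw [show (3 : ZMod 4).val = 3 from rfl, Complex.pos_iff]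
      simp [pow_succ, h0, h1]
    · exact absurd (Complex.ext h0 h1) ha
    · refine key 1 ?_
      rw [show (1 : ZMod 4).val = 1 from rfl, Complex.pos_iff]
      simp [h0, h1]
  · rcases lt_trichotomy (a : ℂ).re 0 with h1 | h1 | h1
    · refine key 2 ?_
      rw [show (2 : ZMod 4).val = 2 from rfl, Complex.pos_iff]
      simp [h0, h1]
    · exact absurd (Complex.ext h1 h0) ha
    · refine key 0 ?_
      rw [ZMod.val_zero, Complex.pos_iff]
      simp [h0, h1]

/-- Every class modulo the continuous symmetries is represented by a product of the two
transformations. -/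
theorem exists_gammaHom_inv_mul_mem {Γ : Equiv.Perm dom} (h : Γ ∈ normalizingGroup) :
    ∃ g, (gammaHom g)⁻¹ * Γ ∈ continuousGroup := by
  have key : ∀ a b, scaling a b ∈ normalizingGroup →
      ∃ m : ZMod 4, (gamma1 ^ m.val)⁻¹ * scaling a b ∈ continuousGroup := by
    intro a b hab
    obtain ⟨ha, hb⟩ := scaling_mem_normalizer_iff.1 hab.2
    obtain ⟨m, r, hr, rfl⟩ := exists_pos_mul_I_pow ha
    refine ⟨m, ?_⟩
    have e : scaling (Units.mk0 Complex.I Complex.I_ne_zero ^ m.val * r) b =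
        scaling (Units.mk0 Complex.I Complex.I_ne_zero ^ m.val) 0 *
          scaling r ((-1) ^ m.val * b) := by
      rw [scaling_mul_scaling, add_zero, Units.val_pow_eq_pow_val, Units.val_mk0, ← mul_assoc,
        ← pow_mul, mul_comm m.val, pow_mul, Complex.I_sq, ← mul_pow]
      simp
    rw [gamma1_pow, e, inv_mul_cancel_left]
    refine scaling_mem_continuousGroup hr ?_
    rcases neg_one_pow_eq_or ℂ m.val with h1 | h1 <;> rw [h1] <;> simp [hb]
  obtain ⟨a, b, rfl | rfl⟩ := isContactSymmetry_iff.1 h.1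
  · obtain ⟨m, hm⟩ := key a b h
    refine ⟨Multiplicative.ofAdd (m, 0), ?_⟩
    rw [gammaHom_apply, ZMod.val_zero, pow_zero, mul_one]
    exact hm
  · obtain ⟨m, hm⟩ := key a b (by
      have := mul_mem h gamma2_mem_normalizingGroup
      rwa [mul_assoc, gamma2_mul_gamma2, mul_one] at this)
    refine ⟨Multiplicative.ofAdd (m, 1), ?_⟩
    have := (Subgroup.mem_normalizer_iff.1 (inv_mem gamma2_mem_normalizer) _).1 hm
    rw [gammaHom_apply, show (1 : ZMod 2).val = 1 from rfl, pow_one, mul_inv_rev]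
    simpa only [inv_inv, mul_assoc] using this

end ContactODE

theorem mainTheorem3 :
    -- the contact symmetries form a group, which contains the continuous ones
    (∃ S : Subgroup (Equiv.Perm ContactODE.dom),
      (∀ Γ, Γ ∈ S ↔ ContactODE.IsContactSymmetry Γ) ∧
      ContactODE.continuousGroup ≤ S ∧
      ContactODE.complexContinuousGroup ≤ S) ∧
    -- every local contact symmetry is one of the eight, up to a complex continuous symmetry
    (∀ (U : Set ContactODE.J1) (F : ContactODE.J1 → ContactODE.J1),
      IsOpen U → IsConnected U → ∀ hU : U ⊆ ContactODE.dom,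
      ContactODE.IsContactSymmetryOn U F →
        ∃ h ∈ Subgroup.closure {ContactODE.gamma1, ContactODE.gamma2},
        ∃ c ∈ ContactODE.complexContinuousGroup,
          ∀ (z : ContactODE.J1) (hz : z ∈ U),
            F z = (((h * c) ⟨z, hU hz⟩ : ContactODE.dom) : ContactODE.J1)) ∧
    -- the contact symmetries that normalize the group of real continuous symmetries, modulo that
    -- group
    (∃ G : Subgroup (Equiv.Perm ContactODE.dom),
      (∀ Γ, Γ ∈ G ↔ ContactODE.IsContactSymmetry Γ ∧
        ∀ c, c ∈ ContactODE.continuousGroup ↔ Γ * c * Γ⁻¹ ∈ ContactODE.continuousGroup) ∧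
      ContactODE.continuousGroup ≤ G ∧
      ∃ (h₁ : ContactODE.gamma1 ∈ G) (h₂ : ContactODE.gamma2 ∈ G)
        (_ : (ContactODE.continuousGroup.subgroupOf G).Normal),
        -- the quotient is of order eight and isomorphic to `ℤ/4 × ℤ/2`, with these generators
        Nat.card (G ⧸ ContactODE.continuousGroup.subgroupOf G) = 8 ∧
        (∃ e : (G ⧸ ContactODE.continuousGroup.subgroupOf G) ≃* Multiplicative (ZMod 4 × ZMod 2),
          e (QuotientGroup.mk ⟨ContactODE.gamma1, h₁⟩) = Multiplicative.ofAdd (1, 0) ∧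
          e (QuotientGroup.mk ⟨ContactODE.gamma2, h₂⟩) = Multiplicative.ofAdd (0, 1)) ∧
        -- the transformations generated by the two given ones are eight, form the same group,
        -- and represent each equivalence class exactly once
        Nat.card (Subgroup.closure {ContactODE.gamma1, ContactODE.gamma2}) = 8 ∧
        Nonempty (Subgroup.closure {ContactODE.gamma1, ContactODE.gamma2} ≃*
          Multiplicative (ZMod 4 × ZMod 2)) ∧
        ∀ Γ ∈ G, ∃! h, h ∈ Subgroup.closure {ContactODE.gamma1, ContactODE.gamma2} ∧
          h⁻¹ * Γ ∈ ContactODE.continuousGroup) := by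
  open ContactODE in
  have hcard : Nat.card (Multiplicative (ZMod 4 × ZMod 2)) = 8 := by
    rw [Nat.card_congr Multiplicative.toAdd, Nat.card_prod, Nat.card_zmod, Nat.card_zmod]
  refine ⟨⟨symmetryGroup, fun _ => Iff.rfl, continuousGroup_le.trans complexContinuousGroup_le,
    complexContinuousGroup_le⟩, ?_, ?_⟩
  · intro U F hU hc hd hF
    obtain ⟨a, b, ha, h | h⟩ := hF.exists_eqOn hU hc hd
    · exact ⟨1, one_mem _, scaling (Units.mk0 a ha) b, scaling_mem_complexContinuousGroup _ _, h⟩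
    · refine ⟨gamma2, Subgroup.subset_closure (by simp), scaling (Units.mk0 a ha) (-b),
        scaling_mem_complexContinuousGroup _ _, fun z hz => ?_⟩
      rw [gamma2_mul_scaling, neg_neg]
      exact h z hz
  · have hle : continuousGroup ≤ normalizingGroup :=
      le_inf (continuousGroup_le.trans complexContinuousGroup_le) Subgroup.le_normalizer
    have hn : (continuousGroup.subgroupOf normalizingGroup).Normal :=
      Subgroup.normal_subgroupOf_iff_le_normalizer hle |>.2 inf_le_right
    obtain ⟨θ, hθ⟩ : ∃ θ : Multiplicative (ZMod 4 × ZMod 2) ≃*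
        normalizingGroup ⧸ continuousGroup.subgroupOf normalizingGroup,
        ∀ g, θ g = QuotientGroup.mk ⟨gammaHom g, gammaHom_mem_normalizingGroup g⟩ := by
      refine ⟨MulEquiv.ofBijective ((QuotientGroup.mk' _).comp
        (gammaHom.codRestrict normalizingGroup gammaHom_mem_normalizingGroup)) ⟨?_, ?_⟩,
        fun g => rfl⟩
      · refine (injective_iff_map_eq_one _).2 fun g hg => eq_one_of_gammaHom_mem ?_
        exact Subgroup.mem_subgroupOf.1 ((QuotientGroup.eq_one_iff _).1 hg)
      · intro q
        obtain ⟨Γ, rfl⟩ := QuotientGroup.mk_surjective q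
        obtain ⟨g, hg⟩ := exists_gammaHom_inv_mul_mem Γ.2
        exact ⟨g, QuotientGroup.eq.2 (Subgroup.mem_subgroupOf.2 hg)⟩
    have eH : Multiplicative (ZMod 4 × ZMod 2) ≃* Subgroup.closure {gamma1, gamma2} :=
      (MonoidHom.ofInjective gammaHom_injective).trans (MulEquiv.subgroupCongr range_gammaHom)
    refine ⟨normalizingGroup, fun Γ => ?_, hle, gamma1_mem_normalizingGroup,
      gamma2_mem_normalizingGroup, hn, ?_, ⟨θ.symm, ?_, ?_⟩, ?_, ⟨eH.symm⟩, fun Γ hΓ => ?_⟩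
    · exact and_congr Iff.rfl Subgroup.mem_normalizer_iff
    · rw [← Nat.card_congr θ.toEquiv, hcard]
    · rw [MulEquiv.symm_apply_eq, hθ]
      simp only [gammaHom_one_zero]
    · rw [MulEquiv.symm_apply_eq, hθ]
      simp only [gammaHom_zero_one]
    · rw [← Nat.card_congr eH.toEquiv, hcard]
    · rw [← range_gammaHom]
      obtain ⟨g, hg⟩ := exists_gammaHom_inv_mul_mem hΓ
      refine ⟨gammaHom g, ⟨⟨g, rfl⟩, hg⟩, ?_⟩
      rintro _ ⟨⟨g', rfl⟩, hg'⟩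
      have := mul_mem hg' (inv_mem hg)
      rw [mul_inv_rev, inv_inv, mul_assoc, mul_inv_cancel_left, ← map_inv, ← map_mul] at this
      rw [inv_mul_eq_one.1 (eq_one_of_gammaHom_mem this)]
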